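/- Let $W_5 = \begin{pmatrix} 0 & -1/\sqrt5 \\ \sqrt5 & 0 \end{pmatrix}$ and let $\Gamma_0^*(5) = \Gamma_0(5) \cup \Gamma_0(5) W_5 \subset \mathrm{SL}_2(\mathbb{R})$ be the Fricke group of level $5$, acting on the upper half plane $\mathbb{H}$ by Möbius transformations. Let $k$ be an integer and let $f$ be a modular function of weight $k$ for $\Gamma_0^*(5)$, that is, a meromorphic function on $\mathbb{H}$ such that $f(\gamma z) = (cz+d)^k f(z)$ (as meromorphic functions) for all $\gamma = \begin{pmatrix} a & b \\ c & d \end{pmatrix} \in \Gamma_0^*(5)$, and such that $f$, as a function of $q = e^{2\pi i z}$, is meromorphic at $q = 0$. Suppose that $f$ is not identically zero. For $p \in \mathbb{H}$ let $v_p(f)$ be the order of $f$ at $p$ (as a function of $z$; it depends only on the class of $p$ in $\Gamma_0^*(5)\backslash\mathbb{H}$), and let $v_\infty(f)$ be the order of $f$ at $q = 0$ as a function of $q$. Put $\rho_{5,1} = -\frac12 + \frac{i}{2\sqrt5}$ and $\rho_{5,2} = -\frac25 + \frac{i}{5}$. Then all these orders are finite, $v_p(f) = 0$ for all but finitely many $p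 \in \Gamma_0^*(5)\backslash\mathbb{H}$, and $$v_\infty(f) + \frac12 v_{i/\sqrt5}(f) + \frac12 v_{\rho_{5,1}}(f) + \frac12 v_{\rho_{5,2}}(f) + \sum_{\substack{p \in \Gamma_0^*(5)\backslash\mathbb{H} \\ p \ne i/\sqrt5,\ \rho_{5,1},\ \rho_{5,2}}} v_p(f) = \frac{k}{4}.$$ -/

import Mathlib

open scoped MatrixGroups Topology UpperHalfPlane

noncomputable section

namespace Fricke

/-- The matrix `W_N = (0, -1/√N; √N, 0)` in `SL(2, ℝ)`. -/
def W (N : ℕ) [NeZero N] : SL(2, ℝ) :=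
  ⟨!![0, -1 / √(N : ℝ); √(N : ℝ), 0], by
    have h : √(N : ℝ) ≠ 0 :=
      (Real.sqrt_pos.mpr (Nat.cast_pos.mpr (Nat.pos_of_ne_zero (NeZero.ne N)))).ne'
    rw [Matrix.det_fin_two_of]
    field_simp
    ring⟩

/-- `Γ₀(N)`, viewed inside `SL(2, ℝ)`. -/
def Gamma0R (N : ℕ) : Subgroup SL(2, ℝ) :=
  (CongruenceSubgroup.Gamma0 N).map (Matrix.SpecialLinearGroup.map (Int.castRingHom ℝ))

theorem mem_Gamma0R {N : ℕ} {g : SL(2, ℝ)} :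
    g ∈ Gamma0R N ↔ ∃ a b c d : ℤ, a * d - b * (N * c) = 1 ∧
      g.1 = !![(a : ℝ), (b : ℝ); (N * c : ℝ), (d : ℝ)] := by
  constructor
  · rintro ⟨A, hA, rfl⟩
    obtain ⟨c, hc⟩ := (ZMod.intCast_zmod_eq_zero_iff_dvd _ N).mp
      (CongruenceSubgroup.Gamma0_mem.mp hA)
    refine ⟨A.1 0 0, A.1 0 1, c, A.1 1 1, ?_, ?_⟩
    · have := A.2
      rw [Matrix.det_fin_two] at this
      rw [← hc]
      exact this
    · have hc' : ((A.1 1 0 : ℤ) : ℝ) = N * c := by exact_mod_cast hc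
      ext i j
      fin_cases i <;> fin_cases j <;> simp [hc']
  · rintro ⟨a, b, c, d, h, hg⟩
    let A : SL(2, ℤ) := ⟨!![a, b; N * c, d], by rw [Matrix.det_fin_two_of]; exact h⟩
    have hA : A.1 = !![a, b; N * c, d] := rfl
    refine ⟨A, ?_, ?_⟩
    · exact CongruenceSubgroup.Gamma0_mem.mpr (by simp [hA])
    · apply Subtype.ext
      rw [hg, Matrix.SpecialLinearGroup.map_apply_coe, hA]
      ext i j
      fin_cases i <;> fin_cases j <;> simp

theorem W_mul_mul_W {N : ℕ} [NeZero N] {g : SL(2, ℝ)} (hg : g ∈ Gamma0R N) :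
    W N * g * W N ∈ Gamma0R N := by
  have hN : (0 : ℝ) < N := Nat.cast_pos.mpr (Nat.pos_of_ne_zero (NeZero.ne N))
  have h : √(N : ℝ) ≠ 0 := (Real.sqrt_pos.mpr hN).ne'
  have hs : √(N : ℝ) * √(N : ℝ) = N := Real.mul_self_sqrt hN.le
  obtain ⟨a, b, c, d, hdet, hg⟩ := mem_Gamma0R.mp hg
  refine mem_Gamma0R.mpr ⟨-d, c, b, -a, by linear_combination hdet, ?_⟩
  rw [Matrix.SpecialLinearGroup.coe_mul, Matrix.SpecialLinearGroup.coe_mul, hg]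
  ext i j
  fin_cases i <;> fin_cases j <;> simp [W, Matrix.mul_apply, Fin.sum_univ_two] <;>
    (field_simp; try rw [pow_two, hs, mul_comm])

theorem W_mul_W {N : ℕ} [NeZero N] : W N * W N = -1 := by
  have h : √(N : ℝ) ≠ 0 :=
    (Real.sqrt_pos.mpr (Nat.cast_pos.mpr (Nat.pos_of_ne_zero (NeZero.ne N)))).ne'
  apply Subtype.ext
  rw [Matrix.SpecialLinearGroup.coe_mul, Matrix.SpecialLinearGroup.coe_neg]
  ext i j
  fin_cases i <;> fin_cases j <;> simp [W] <;> field_simp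

theorem neg_mem {N : ℕ} {g : SL(2, ℝ)} (hg : g ∈ Gamma0R N) : -g ∈ Gamma0R N := by
  obtain ⟨a, b, c, d, hdet, hg⟩ := mem_Gamma0R.mp hg
  refine mem_Gamma0R.mpr ⟨-a, -b, -c, -d, by linear_combination hdet, ?_⟩
  rw [Matrix.SpecialLinearGroup.coe_neg, hg]
  ext i j
  fin_cases i <;> fin_cases j <;> simp

/-- The Fricke group `Γ₀*(N) = Γ₀(N) ∪ Γ₀(N) W_N`, a subgroup of `SL(2, ℝ)`. -/
def Gamma0Star (N : ℕ) [NeZero N] : Subgroup SL(2, ℝ) where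
  carrier := {g | g ∈ Gamma0R N ∨ ∃ h ∈ Gamma0R N, g = h * W N}
  one_mem' := Or.inl (one_mem _)
  mul_mem' := by
    rintro x y (hx | ⟨x, hx, rfl⟩) (hy | ⟨y, hy, rfl⟩)
    · exact Or.inl (mul_mem hx hy)
    · exact Or.inr ⟨x * y, mul_mem hx hy, by group⟩
    · refine Or.inr ⟨-(x * (W N * y * W N)),
        neg_mem (mul_mem hx (W_mul_mul_W hy)), ?_⟩
      simp only [neg_mul, mul_assoc, W_mul_W, mul_neg, mul_one, neg_neg]
    · refine Or.inl ?_
      have := mul_mem hx (W_mul_mul_W hy)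
      simpa only [mul_assoc] using this
  inv_mem' := by
    rintro x (hx | ⟨x, hx, rfl⟩)
    · exact Or.inl (inv_mem hx)
    · refine Or.inr ⟨-(-(W N * x⁻¹ * W N)), neg_mem (neg_mem (W_mul_mul_W (inv_mem hx))), ?_⟩
      have hW : (W N)⁻¹ = -W N := by
        rw [inv_eq_iff_mul_eq_one, mul_neg, W_mul_W, neg_neg]
      rw [mul_inv_rev, hW]
      simp only [neg_mul, neg_neg, mul_assoc, W_mul_W, mul_neg, mul_one]

/-- A modular function of weight `k` for `Γ₀*(p)`, `p` prime: a meromorphic function on the upper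
half plane that satisfies `f (γ z) = (c z + d) ^ k f z` for all `γ = (a, b; c, d)` in `Γ₀*(p)`, as
an identity of meromorphic functions (i.e. for all `z` outside a closed discrete subset of the
upper half plane, since `f` carries no meaningful value at its poles), and that is meromorphic at
the cusp `∞`, i.e. as a function of `q = exp (2 π i z)` at `q = 0`.

The cusp `∞` has width `1` and is the only cusp of `Γ₀*(p)` up to equivalence. -/
structure ModularFunction (p : ℕ) [Fact p.Prime] (k : ℤ) where
  toFun : ℍ → ℂ
  meromorphic : ∀ z : ℍ, MeromorphicAt (toFun ∘ UpperHalfPlane.ofComplex) (z : ℂ)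
  transform : ∀ γ ∈ Gamma0Star p, ∀ᶠ z in Filter.codiscrete ℍ,
    toFun (γ • z) = ((γ.1 1 0 : ℂ) * (z : ℂ) + (γ.1 1 1 : ℂ)) ^ k * toFun z
  meromorphic_infty : MeromorphicAt (UpperHalfPlane.cuspFunction 1 toFun) 0

namespace ModularFunction

variable {p : ℕ} [Fact p.Prime] {k : ℤ} (f : ModularFunction p k)

/-- `f` is identically zero, as a meromorphic function. -/
def IsZero : Prop := ∀ᶠ z in Filter.codiscrete ℍ, f.toFun z = 0

/-- The order `v_z(f)` of `f` at a point `z` of the upper half plane. -/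
def order (z : ℍ) : WithTop ℤ :=
  meromorphicOrderAt (f.toFun ∘ UpperHalfPlane.ofComplex) (z : ℂ)

/-- The order `v_∞(f)` of `f` at `∞`: the order at `q = 0` of `f` as a function of
`q = exp (2 π i z)`. -/
def orderInfty : WithTop ℤ :=
  meromorphicOrderAt (UpperHalfPlane.cuspFunction 1 f.toFun) 0

/-- The order is constant on the orbits of `Γ₀*(p)`. -/
theorem order_smul {γ : SL(2, ℝ)} (hγ : γ ∈ Gamma0Star p) (z : ℍ) :
    f.order (γ • z) = f.order z := by
  have hg : 0 < (γ : GL (Fin 2) ℝ).val.det := by simp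
  have h1 := UpperHalfPlane.meromorphicOrderAt_comp_smul (f := f.toFun) (τ := z) hg
  have hden : ((γ.1 1 0 : ℂ) * (z : ℂ) + (γ.1 1 1 : ℂ)) ≠ 0 :=
    UpperHalfPlane.denom_ne_zero (γ : GL (Fin 2) ℝ) z
  have han : AnalyticAt ℂ (fun w : ℂ ↦ ((γ.1 1 0 : ℂ) * w + (γ.1 1 1 : ℂ)) ^ k) (z : ℂ) := by
    have h0 : AnalyticAt ℂ (fun w : ℂ ↦ (γ.1 1 0 : ℂ) * w + (γ.1 1 1 : ℂ)) (z : ℂ) := by fun_prop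
    exact h0.zpow hden
  have h2 : ∀ᶠ w in 𝓝[≠] (z : ℂ), f.toFun (γ • UpperHalfPlane.ofComplex w) =
      ((γ.1 1 0 : ℂ) * w + (γ.1 1 1 : ℂ)) ^ k *
        (f.toFun ∘ UpperHalfPlane.ofComplex) w := by
    have ht := f.transform γ hγ
    have ht' : ∀ᶠ y in 𝓝[≠] z, f.toFun (γ • y) =
        ((γ.1 1 0 : ℂ) * (y : ℂ) + (γ.1 1 1 : ℂ)) ^ k * f.toFun y :=
      by
        have := (mem_codiscrete.mp ht) z
        rwa [Filter.disjoint_principal_right, compl_compl] at this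
    rw [eventually_nhdsWithin_iff] at ht' ⊢
    rw [← UpperHalfPlane.isOpenEmbedding_coe.map_nhds_eq, Filter.eventually_map]
    filter_upwards [ht'] with y hy hne
    have := hy (fun h ↦ hne (by simp_all))
    simpa using this
  have h3 := meromorphicOrderAt_congr (f₁ := fun w ↦ f.toFun (γ • UpperHalfPlane.ofComplex w)) h2
  have h4 : meromorphicOrderAt
      (fun w : ℂ ↦ ((γ.1 1 0 : ℂ) * w + (γ.1 1 1 : ℂ)) ^ k) (z : ℂ) = 0 := by
    rw [han.meromorphicOrderAt_eq, han.analyticOrderAt_eq_zero.mpr (zpow_ne_zero k hden)]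
    rfl
  have h5 := meromorphicOrderAt_mul han.meromorphicAt (f.meromorphic z)
  rw [h4, zero_add] at h5
  exact h1.symm.trans (h3.trans h5)

/-- The order of `f` at a point of the quotient `Γ₀*(p) \ ℍ`. -/
def orderAt : MulAction.orbitRel.Quotient (Gamma0Star p) ℍ → WithTop ℤ :=
  Quotient.lift f.order (by
    rintro _ z ⟨γ, rfl⟩
    exact f.order_smul γ.2 z)

end ModularFunction

instance : Fact (Nat.Prime 5) := ⟨by norm_num⟩

/-- The point `i / √5`. -/
def iDivSqrtFive : ℍ := ⟨⟨0, 1 / √5⟩, by simp⟩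

/-- The point `ρ_{5,1} = -1/2 + i / (2 √5)`. -/
def rho51 : ℍ := ⟨⟨-1 / 2, 1 / (2 * √5)⟩, by simp⟩

/-- The point `ρ_{5,2} = -2/5 + i / 5`. -/
def rho52 : ℍ := ⟨⟨-2 / 5, 1 / 5⟩, by simp⟩

/-- The class of a point of the upper half plane in `Γ₀*(5) \ ℍ`. -/
def cls (z : ℍ) : MulAction.orbitRel.Quotient (Gamma0Star 5) ℍ := Quotient.mk _ z

end Fricke

end

noncomputable section

namespace Fricke

open Filter
open scoped Pointwise
open Function.Periodic (qParam invQParam qParam_right_inv qParam_left_inv_mod_period)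
open UpperHalfPlane (ofComplex cuspFunction)

/-! No contour integration is used: the formula says that a weight `0` function has a divisor of
degree zero on the compactified quotient.

The form Δ(z)Δ(5z) (`discFive`) has weight 24 for Γ₀*(5), has no zero on ℍ, and has order 1 + 5 = 6
at the cusp. So g = f²⁴ / (Δ(z)Δ(5z))ᵏ (`normalize`) has weight 0, with orders 24 v_p(f) on ℍ and 24
v_∞(f) − 6k at ∞.

For nonconstant g, let N_c(g) count the solutions of g = c on the one-point compactification of
Γ₀*(5)\ℍ, a point of ℍ having weight 1/|Stab| and the cusp weight 1/2. By Hurwitz's theorem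
(`exists_nhds_finsum_zeroOrd`), combined with orbit–stabilizer (`finsum_orbit_eq_finsum`), local
counts do not change when c moves slightly. Compactness makes N_c locally constant in c
(`finsum_eq_finsum_of_local`), hence constant on ℂ. As g and 1/g take the value 1 at the same points
with the same multiplicities, N_0(g) = N_1(g) = N_1(1/g) = N_0(1/g): there are as many zeros as
poles (`sum_order_eq_zero`).

Stabilizers contain ±1. They have order 4 on the three elliptic orbits and 2 elsewhere, so doubling
the weights 1/|Stab| gives the coefficients 1/2 and 1. -/

/-! ### Local theory: Hurwitz's theorem for meromorphic functions. -/

theorem eventually_nhds_eventually_nhdsNE {X : Type*} [TopologicalSpace X] [T1Space X] {x : X}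
    {P : X → Prop} (h : ∀ᶠ y in 𝓝[≠] x, P y) : ∀ᶠ z in 𝓝 x, ∀ᶠ y in 𝓝[≠] z, P y := by
  have h1 := eventually_eventually_nhdsWithin.mpr h
  rw [eventually_nhdsWithin_iff] at h1
  filter_upwards [h1] with z hz
  by_cases hz0 : z = x
  · rwa [hz0]
  · have := hz hz0
    rw [isOpen_compl_singleton.nhdsWithin_eq hz0] at this
    exact this.filter_mono nhdsWithin_le_nhds

/-- The order of vanishing of `F - c` at `z`, and `0` at the poles of `F`. -/
def zeroOrd (F : ℂ → ℂ) (c z : ℂ) : ℕ :=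
  (meromorphicOrderAt (fun w ↦ F w - c) z).untop₀.toNat

theorem zeroOrd_congr {F G : ℂ → ℂ} {z : ℂ} (h : F =ᶠ[𝓝[≠] z] G) (c : ℂ) :
    zeroOrd F c z = zeroOrd G c z := by
  unfold zeroOrd
  rw [meromorphicOrderAt_congr]
  filter_upwards [h] with w hw
  rw [hw]

theorem zeroOrd_eq_zero_of_le_norm {F : ℂ → ℂ} {c z : ℂ} {δ : ℝ} (hδ : 0 < δ)
    (h : ∀ᶠ w in 𝓝[≠] z, δ ≤ ‖F w - c‖) : zeroOrd F c z = 0 := by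
  unfold zeroOrd
  rw [Int.toNat_eq_zero]
  by_contra! hpos
  have h0 : 0 < meromorphicOrderAt (fun w ↦ F w - c) z := by
    -- `untop₀` sends `⊤` to `0`, so positivity excludes infinite order.
    by_cases ht : meromorphicOrderAt (fun w ↦ F w - c) z = ⊤
    · simp [ht] at hpos
    · rw [← WithTop.coe_untop₀_of_ne_top ht]
      exact_mod_cast hpos
  have ht := (tendsto_zero_of_meromorphicOrderAt_pos h0).norm
  rw [norm_zero] at ht
  obtain ⟨w, hw1, hw2⟩ := (h.and (ht.eventually (gt_mem_nhds hδ))).exists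
  linarith

theorem zeroOrd_eq_zero_of_analyticAt {F : ℂ → ℂ} {c z : ℂ} (hF : AnalyticAt ℂ F z)
    (h : F z ≠ c) : zeroOrd F c z = 0 := by
  unfold zeroOrd
  have : AnalyticAt ℂ (fun w ↦ F w - c) z := by fun_prop
  rw [this.meromorphicOrderAt_eq, this.analyticOrderAt_eq_zero.mpr (sub_ne_zero.mpr h)]
  rfl

theorem zeroOrd_eq_one_of_deriv_ne_zero {F : ℂ → ℂ} {z : ℂ} (hF : AnalyticAt ℂ F z)
    (h : deriv F z ≠ 0) : zeroOrd F (F z) z = 1 := by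
  unfold zeroOrd
  have : AnalyticAt ℂ (fun w ↦ F w - F z) z := by fun_prop
  rw [this.meromorphicOrderAt_eq, hF.analyticOrderAt_sub_eq_one_of_deriv_ne_zero h]
  rfl

/-- The order of a function is zero in the neighbourhood of a non-zero of `F - c₀`. -/
theorem eventually_zeroOrd_eq_zero {F : ℂ → ℂ} {c₀ z₀ : ℂ} (hF : MeromorphicAt F z₀)
    (h : meromorphicOrderAt (fun w ↦ F w - c₀) z₀ ≤ 0) :
    ∃ U₀ ∈ 𝓝 z₀, ∀ᶠ c in 𝓝 c₀, ∀ z ∈ U₀, zeroOrd F c z = 0 := by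
  have hm : MeromorphicAt (fun w ↦ F w - c₀) z₀ := by fun_prop
  -- The bound is `2 * δ` so that moving `c` by less than `δ` still leaves `δ ≤ ‖F w - c‖`.
  obtain ⟨δ, hδ, hev⟩ : ∃ δ > 0, ∀ᶠ w in 𝓝[≠] z₀, 2 * δ ≤ ‖F w - c₀‖ := by
    rcases h.lt_or_eq with h | h
    · have := tendsto_norm_cobounded_atTop.comp (tendsto_cobounded_of_meromorphicOrderAt_neg h)
      exact ⟨1, one_pos, this.eventually (eventually_ge_atTop _)⟩
    · obtain ⟨l, hl, hlim⟩ := tendsto_ne_zero_of_meromorphicOrderAt_eq_zero hm h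
      have hl' := norm_pos_iff.mpr hl
      refine ⟨‖l‖ / 4, by positivity, ?_⟩
      filter_upwards [hlim.norm.eventually (lt_mem_nhds (half_lt_self hl'))] with w hw
      linarith
  have hev' := eventually_nhds_eventually_nhdsNE hev
  refine ⟨_, hev', ?_⟩
  filter_upwards [Metric.ball_mem_nhds c₀ hδ] with c hc z hz
  refine zeroOrd_eq_zero_of_le_norm hδ (hz.mono fun w hw ↦ ?_)
  have h1 : ‖F w - c₀‖ ≤ ‖F w - c‖ + ‖c - c₀‖ := by
    simpa using norm_add_le (F w - c) (c - c₀)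
  rw [Metric.mem_ball, dist_eq_norm] at hc
  linarith

/-- An `m`-th root of `F - c₀` near a zero of order `m`. -/
theorem exists_pow_eq_near_zero {F : ℂ → ℂ} {c₀ z₀ : ℂ} (hF : MeromorphicAt F z₀) {m : ℕ}
    (hm0 : m ≠ 0) (h : meromorphicOrderAt (fun w ↦ F w - c₀) z₀ = (m : ℤ)) :
    ∃ H : ℂ → ℂ, AnalyticAt ℂ H z₀ ∧ H z₀ = 0 ∧ deriv H z₀ ≠ 0 ∧
      F =ᶠ[𝓝[≠] z₀] fun w ↦ c₀ + H w ^ m := by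
  have hm : MeromorphicAt (fun w ↦ F w - c₀) z₀ := by fun_prop
  obtain ⟨g, hg, hg0, hgF⟩ := (meromorphicOrderAt_eq_int_iff hm).mp h
  obtain ⟨β, hβ⟩ := IsAlgClosed.exists_pow_nat_eq (g z₀) (Nat.pos_of_ne_zero hm0)
  have hβ0 : β ≠ 0 := by
    rintro rfl
    exact hg0 (by rw [← hβ, zero_pow hm0])
  -- The quotient `g / g z₀` equals 1 at `z₀`, so its principal power is analytic there; the
  -- constant `β` restores an `m`-th root of `g`.
  have hr : AnalyticAt ℂ (fun w ↦ β * (g w / g z₀) ^ ((m : ℂ)⁻¹)) z₀ := by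
    refine analyticAt_const.mul (AnalyticAt.cpow (by fun_prop (disch := exact hg0))
      analyticAt_const ?_)
    rw [div_self hg0]
    exact Complex.one_mem_slitPlane
  have hsub : AnalyticAt ℂ (fun w : ℂ ↦ w - z₀) z₀ := by fun_prop
  refine ⟨fun w ↦ (w - z₀) * (β * (g w / g z₀) ^ ((m : ℂ)⁻¹)), hsub.mul hr, by simp, ?_, ?_⟩
  · rw [deriv_fun_mul hsub.differentiableAt hr.differentiableAt]
    simp [div_self hg0, hβ0]
  · filter_upwards [hgF] with w hw
    rw [mul_pow, mul_pow, Complex.cpow_nat_inv_pow _ hm0, hβ, mul_div_cancel₀ _ hg0]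
    rw [zpow_natCast, smul_eq_mul] at hw
    rw [← hw]
    ring

theorem ncard_setOf_pow_eq {m : ℕ} (hm : m ≠ 0) {a : ℂ} (ha : a ≠ 0) :
    {x : ℂ | x ^ m = a}.ncard = m := by
  have hζ := Complex.isPrimitiveRoot_exp m hm
  have hset : {x : ℂ | x ^ m = a} = ((Polynomial.nthRoots m a).toFinset : Set ℂ) := by
    ext x
    simp [Polynomial.mem_nthRoots (Nat.pos_of_ne_zero hm)]
  rw [hset, Set.ncard_coe_finset, Multiset.toFinset_card_of_nodup (hζ.nthRoots_nodup ha),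
    hζ.card_nthRoots, if_pos (IsAlgClosed.exists_pow_nat_eq a (Nat.pos_of_ne_zero hm))]

/-- **Hurwitz**: a zero of order `m` of `F - c₀` splits into zeros of total order `m` of `F - c`,
for `c` near `c₀`. -/
theorem exists_nhds_finsum_zeroOrd {F : ℂ → ℂ} {c₀ z₀ : ℂ} (hF : MeromorphicAt F z₀)
    (hne : meromorphicOrderAt (fun w ↦ F w - c₀) z₀ ≠ ⊤) :
    ∃ U₀ ∈ 𝓝 z₀, ∀ U ∈ 𝓝 z₀, U ⊆ U₀ → ∀ᶠ c in 𝓝 c₀,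
      (U ∩ Function.support (zeroOrd F c)).Finite ∧
        ∑ᶠ z ∈ U, zeroOrd F c z = zeroOrd F c₀ z₀ := by
  rcases le_or_gt (meromorphicOrderAt (fun w ↦ F w - c₀) z₀) 0 with hle | hgt
  · obtain ⟨U₀, hU₀, hz⟩ := eventually_zeroOrd_eq_zero hF hle
    refine ⟨U₀, hU₀, fun U hU hUU ↦ ?_⟩
    filter_upwards [hz] with c hc
    have he : U ∩ Function.support (zeroOrd F c) = ∅ := by
      ext z
      simpa using fun hz ↦ hc z (hUU hz)
    rw [he, finsum_mem_eq_zero_of_forall_eq_zero fun z hz ↦ hc z (hUU hz),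
      hz.self_of_nhds z₀ (mem_of_mem_nhds hU₀)]
    exact ⟨Set.finite_empty, rfl⟩
  obtain ⟨n, hn⟩ := WithTop.ne_top_iff_exists.mp hne
  rw [← hn] at hgt
  have hn0 : 0 < n := by exact_mod_cast hgt
  obtain ⟨m, rfl⟩ := Int.eq_ofNat_of_zero_le hn0.le
  have hm0 : m ≠ 0 := by omega
  have hval : zeroOrd F c₀ z₀ = m := by
    unfold zeroOrd
    rw [← hn]
    simp
  obtain ⟨H, hH, hH0, hH', hFH⟩ := exists_pow_eq_near_zero hF hm0 hn.symm
  have hstrict : HasStrictDerivAt H (deriv H z₀) z₀ := hH.hasStrictDerivAt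
  have hinv := hstrict.eventually_left_inverse hH'
  have hd : ∀ᶠ z in 𝓝 z₀, deriv H z ≠ 0 :=
    hH.deriv.continuousAt.eventually_ne hH'
  have hFH' : ∀ᶠ z in 𝓝 z₀, F =ᶠ[𝓝[≠] z] fun w ↦ c₀ + H w ^ m :=
    eventually_nhds_eventually_nhdsNE hFH
  -- Every smaller neighbourhood is allowed, so that `U` can later be a disc or a set stable under a
  -- stabilizer.
  refine ⟨_, hinv.and (hd.and (hFH'.and hH.eventually_analyticAt)), fun U hU hUU ↦ ?_⟩
  have hinj : Set.InjOn H U := fun x hx y hy hxy ↦ by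
    rw [← (hUU hx).1, ← (hUU hy).1, hxy]
  have hz₀ : z₀ ∈ U := mem_of_mem_nhds hU
  -- Off `c₀` all solutions are simple, since the derivative `m H^(m-1) H'` vanishes only where `H`
  -- does.
  have hne : ∀ c ≠ c₀, ∀ z ∈ U, zeroOrd F c z = if H z ^ m = c - c₀ then 1 else 0 := by
    intro c hc z hz
    obtain ⟨-, hdz, hFz, hHz⟩ := hUU hz
    have hK : AnalyticAt ℂ (fun w ↦ c₀ + H w ^ m) z := by fun_prop
    rw [zeroOrd_congr hFz]
    split_ifs with hif
    · have hv : c = (fun w ↦ c₀ + H w ^ m) z := by simp [hif]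
      have hHz0 : H z ≠ 0 := fun h0 ↦ sub_ne_zero.mpr hc (by rw [← hif, h0, zero_pow hm0])
      rw [hv]
      refine zeroOrd_eq_one_of_deriv_ne_zero hK ?_
      rw [deriv_const_add, deriv_fun_pow hHz.differentiableAt]
      exact mul_ne_zero (mul_ne_zero (by exact_mod_cast hm0) (pow_ne_zero _ hHz0)) hdz
    · refine zeroOrd_eq_zero_of_analyticAt hK fun h0 ↦ hif ?_
      rw [← h0]
      ring
  have heq : ∀ z ∈ U, z ≠ z₀ → zeroOrd F c₀ z = 0 := by
    intro z hz hzz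
    obtain ⟨-, -, hFz, hHz⟩ := hUU hz
    rw [zeroOrd_congr hFz]
    refine zeroOrd_eq_zero_of_analyticAt (by fun_prop) fun h0 ↦ hzz (hinj hz hz₀ ?_)
    rw [add_eq_left, pow_eq_zero_iff hm0] at h0
    rw [h0, hH0]
  have himg : H '' U ∈ 𝓝 (0 : ℂ) := by
    rw [← hH0, ← hstrict.map_nhds_eq hH']
    exact image_mem_map hU
  obtain ⟨ε, hε, hball⟩ := Metric.mem_nhds_iff.mp himg
  -- With `c` within `ε ^ m` of `c₀`, every `m`-th root of `c - c₀` has norm below `ε`, hence is a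
  -- value of `H` on `U`.
  filter_upwards [Metric.ball_mem_nhds c₀ (pow_pos hε m)] with c hc
  by_cases hcc : c = c₀
  · subst hcc
    have hsub : U ∩ Function.support (zeroOrd F c) ⊆ {z₀} := fun z hz ↦ by
      by_contra hzz
      exact hz.2 (heq z hz.1 hzz)
    refine ⟨(Set.finite_singleton z₀).subset hsub, ?_⟩
    rw [finsum_mem_eq_sum_of_inter_support_eq (t := {z₀}) _ ?_, Finset.sum_singleton]
    ext z
    simp only [Set.mem_inter_iff, Finset.coe_singleton, Set.mem_singleton_iff]
    exact ⟨fun hz ↦ ⟨hsub hz, hz.2⟩, fun hz ↦ ⟨hz.1 ▸ hz₀, hz.2⟩⟩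
  · have hsupp : U ∩ Function.support (zeroOrd F c) = {z ∈ U | H z ^ m = c - c₀} := by
      ext z
      simp only [Set.mem_inter_iff, Function.mem_support, Set.mem_ofPred_eq]
      refine and_congr_right fun hz ↦ ?_
      rw [hne c hcc z hz]
      split_ifs <;> simp_all
    have hcard : {z ∈ U | H z ^ m = c - c₀}.ncard = m := by
      rw [← (hinj.mono fun z hz ↦ hz.1 : Set.InjOn H {z ∈ U | H z ^ m = c - c₀}).ncard_image]
      refine Eq.trans (congrArg Set.ncard ?_) (ncard_setOf_pow_eq hm0 (sub_ne_zero.mpr hcc))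
      ext x
      constructor
      · rintro ⟨z, hz, rfl⟩
        exact hz.2
      · intro hx
        have : x ∈ Metric.ball (0 : ℂ) ε := by
          rw [Metric.mem_ball, dist_zero_right]
          rw [Metric.mem_ball, dist_eq_norm, ← Set.mem_ofPred_eq.mp hx, norm_pow] at hc
          exact lt_of_pow_lt_pow_left₀ m hε.le hc
        obtain ⟨z, hz, rfl⟩ := hball this
        exact ⟨z, ⟨hz, hx⟩, rfl⟩
    have hfin : {z ∈ U | H z ^ m = c - c₀}.Finite :=
      Set.finite_of_ncard_ne_zero (by rwa [hcard])
    refine ⟨hsupp ▸ hfin, ?_⟩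
    rw [hval, ← hcard, ← finsum_mem_inter_support, hsupp, Set.ncard_eq_toFinset_card _ hfin,
      finsum_mem_eq_finite_toFinset_sum _ hfin, Finset.card_eq_sum_ones]
    refine Finset.sum_congr rfl fun z hz ↦ ?_
    obtain ⟨h1, h2⟩ := hfin.mem_toFinset.mp hz
    rw [hne c hcc z h1, if_pos h2]

/-! ### From local to global counts, and from points to orbits. -/

theorem eq_zero_of_finsum_mem_eq_zero {X : Type*} {n : X → ℚ} (hn : ∀ x, 0 ≤ n x) {U : Set X}
    (hfin : (U ∩ Function.support n).Finite) (h : ∑ᶠ x ∈ U, n x = 0) {x : X} (hx : x ∈ U) :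
    n x = 0 := by
  by_contra hne
  rw [← finsum_mem_inter_support, finsum_mem_eq_finite_toFinset_sum _ hfin,
    Finset.sum_eq_zero_iff_of_nonneg fun y _ ↦ hn y] at h
  exact hne (h x (by simp [hx, hne]))

/-- A family of nonnegative functions on a compact Hausdorff space, with locally constant local
sums, has a constant sum. -/
theorem finsum_eq_finsum_of_local {X : Type*} [TopologicalSpace X] [CompactSpace X] [T2Space X]
    {n : ℂ → X → ℚ} (hn : ∀ c x, 0 ≤ n c x)
    (hloc : ∀ c₀ x, ∀ V ∈ 𝓝 x, ∃ U ∈ 𝓝 x, U ⊆ V ∧ ∀ᶠ c in 𝓝 c₀,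
      (U ∩ Function.support (n c)).Finite ∧ ∑ᶠ y ∈ U, n c y = n c₀ x) :
    (∀ c, (Function.support (n c)).Finite) ∧ ∀ c c', ∑ᶠ x, n c x = ∑ᶠ x, n c' x := by
  have hfin : ∀ c, (Function.support (n c)).Finite := by
    intro c
    choose U hU _ hev using fun x ↦ hloc c x Set.univ univ_mem
    obtain ⟨t, -, ht⟩ := isCompact_univ.elim_nhds_subcover U fun x _ ↦ hU x
    refine (t.finite_toSet.biUnion fun x _ ↦ (hev x).self_of_nhds.1).subset fun y hy ↦ ?_
    obtain ⟨x, hx, hyx⟩ := Set.mem_iUnion₂.mp (ht (Set.mem_univ y))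
    exact Set.mem_biUnion hx ⟨hyx, hy⟩
  refine ⟨hfin, fun c c' ↦ ?_⟩
  have hlc : IsLocallyConstant fun c ↦ ∑ᶠ x, n c x := by
    rw [IsLocallyConstant.iff_eventually_eq]
    intro c₀
    have hS := hfin c₀
    obtain ⟨V, hV, hdisj⟩ := hS.t2_separation
    choose U hU hUV hev using fun x ↦ hloc c₀ x (V x) ((hV x).2.mem_nhds (hV x).1)
    obtain ⟨t, -, ht⟩ := isCompact_univ.elim_nhds_subcover U fun x _ ↦ hU x
    have h1 : ∀ᶠ c in 𝓝 c₀, ∀ x ∈ (t : Set X) ∪ Function.support (n c₀),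
        (U x ∩ Function.support (n c)).Finite ∧ ∑ᶠ y ∈ U x, n c y = n c₀ x :=
      (t.finite_toSet.union hS).eventually_all.mpr fun x _ ↦ hev x
    filter_upwards [h1] with c hc
    -- The finite subcover leaves no room for new points: where `n c₀ x = 0` the local sum stays 0,
    -- and nonnegativity then kills every term.
    have hsupp : Function.support (n c) =
        ⋃ x ∈ Function.support (n c₀), U x ∩ Function.support (n c) := by
      refine Set.Subset.antisymm (fun y hy ↦ ?_) (Set.iUnion₂_subset fun x _ ↦ Set.inter_subset_right)
      obtain ⟨x, hx, hyx⟩ := Set.mem_iUnion₂.mp (ht (Set.mem_univ y))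
      obtain ⟨h2, h3⟩ := hc x (Or.inl hx)
      refine Set.mem_biUnion (x := x) (fun h0 ↦ hy ?_) ⟨hyx, hy⟩
      exact eq_zero_of_finsum_mem_eq_zero (hn c) h2 (h3.trans h0) hyx
    rw [← finsum_mem_support, hsupp, finsum_mem_biUnion _ hS fun x hx ↦ (hc x (Or.inr hx)).1,
      ← finsum_mem_support (n c₀)]
    · refine finsum_mem_congr rfl fun x hx ↦ ?_
      rw [finsum_mem_inter_support, (hc x (Or.inr hx)).2]
    · exact fun x hx y hy hxy ↦ (hdisj hx hy hxy).mono
        (Set.inter_subset_left.trans (hUV x)) (Set.inter_subset_left.trans (hUV y))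
  exact hlc.apply_eq_of_isPreconnected isPreconnected_univ trivial trivial

/-- Counting orbits near a point `p` in terms of the points near `p`. -/
theorem finsum_orbit_eq_finsum {G T : Type*} [Group G] [MulAction G T] {p : T}
    [Finite (MulAction.stabilizer G p)] {U : Set T}
    (hU : ∀ γ : G, ∀ q ∈ U, γ • q ∈ U ↔ γ • p = p)
    {o : T → ℕ} {m : MulAction.orbitRel.Quotient G T → ℚ}
    (hm : ∀ q, m (Quotient.mk _ q) = (o q : ℚ) / Nat.card (MulAction.stabilizer G q))
    (hfin : (U ∩ Function.support o).Finite) :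
    ((Quotient.mk (MulAction.orbitRel G T) '' U) ∩ Function.support m).Finite ∧
      ∑ᶠ y ∈ Quotient.mk (MulAction.orbitRel G T) '' U, m y =
        ((∑ᶠ q ∈ U, o q : ℕ) : ℚ) / Nat.card (MulAction.stabilizer G p) := by
  classical
  have hstab : ∀ q ∈ U, MulAction.stabilizer G q ≤ MulAction.stabilizer G p := fun q hq γ hγ ↦
    (hU γ q hq).mp (by rwa [MulAction.mem_stabilizer_iff.mp hγ])
  have hsupp : ∀ q ∈ U, m (Quotient.mk _ q) = 0 ↔ o q = 0 := by
    intro q hq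
    have : Finite (MulAction.stabilizer G q) :=
      Finite.of_injective _ (Subgroup.inclusion_injective (hstab q hq))
    rw [hm, div_eq_zero_iff, Nat.cast_eq_zero, Nat.cast_eq_zero, or_iff_left Nat.card_pos.ne']
  set S := hfin.toFinset with hS
  have hmemS : ∀ q, q ∈ S ↔ q ∈ U ∧ o q ≠ 0 := fun q ↦ by simp [hS]
  have himg : (Quotient.mk (MulAction.orbitRel G T) '' U) ∩ Function.support m =
      S.image (Quotient.mk (MulAction.orbitRel G T)) := by
    ext y
    simp only [Set.mem_inter_iff, Set.mem_image, Function.mem_support, Finset.coe_image,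
      Finset.mem_coe, hmemS]
    constructor
    · rintro ⟨⟨q, hq, rfl⟩, hy⟩
      exact ⟨q, ⟨hq, fun h0 ↦ hy ((hsupp q hq).mpr h0)⟩, rfl⟩
    · rintro ⟨q, ⟨hq, h0⟩, rfl⟩
      exact ⟨⟨q, hq, rfl⟩, fun hy ↦ h0 ((hsupp q hq).mp hy)⟩
  refine ⟨himg ▸ Finset.finite_toSet _, ?_⟩
  rw [← finsum_mem_inter_support, himg, finsum_mem_coe_finset, ← finsum_mem_inter_support,
    finsum_mem_eq_finite_toFinset_sum _ hfin, ← hS, Nat.cast_sum, Finset.sum_div,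
    ← Finset.sum_fiberwise_of_maps_to fun q hq ↦
      Finset.mem_image_of_mem (Quotient.mk (MulAction.orbitRel G T)) hq]
  refine Finset.sum_congr rfl fun y hy ↦ ?_
  obtain ⟨q, hq, rfl⟩ := Finset.mem_image.mp hy
  obtain ⟨hqU, hq0⟩ := (hmemS q).mp hq
  have : Finite (MulAction.stabilizer G q) :=
    Finite.of_injective _ (Subgroup.inclusion_injective (hstab q hqU))
  have ho : ∀ q', Quotient.mk (MulAction.orbitRel G T) q' = Quotient.mk _ q → q' ∈ U →
      o q' = o q := by
    intro q' hq' hq'U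
    obtain ⟨γ, hγ⟩ := Quotient.exact hq'
    have hc : Nat.card (MulAction.stabilizer G q') = Nat.card (MulAction.stabilizer G q) :=
      Nat.card_congr (MulAction.stabilizerEquivStabilizerOfOrbitRel (Quotient.exact hq')).toEquiv
    have := hm q'
    rw [hq', hm q, hc, div_left_inj' (by exact_mod_cast Nat.card_pos.ne')] at this
    exact_mod_cast this.symm
  -- The points of `U` in the class of `q` form one orbit of the stabilizer of `p`, of size |Stab p|
  -- / |Stab q|. This factor turns the weight 1/|Stab q| of the class into 1/|Stab p| for each
  -- point.
  have hfib : ((S.filter fun q' ↦ Quotient.mk (MulAction.orbitRel G T) q' = Quotient.mk _ q :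
      Finset T) : Set T) = MulAction.orbit (MulAction.stabilizer G p) q := by
    ext q'
    rw [Finset.mem_coe, Finset.mem_filter, hmemS]
    constructor
    · rintro ⟨⟨h1, -⟩, h2⟩
      obtain ⟨γ, hγ⟩ := Quotient.exact h2
      simp only at hγ
      exact ⟨⟨γ, (hU γ q hqU).mp (by rwa [hγ])⟩, hγ⟩
    · rintro ⟨γ, rfl⟩
      have h1 : (γ : G) • q ∈ U := (hU γ q hqU).mpr γ.2
      have h2 : Quotient.mk (MulAction.orbitRel G T) ((γ : G) • q) = Quotient.mk _ q :=
        Quotient.sound ⟨γ, rfl⟩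
      exact ⟨⟨h1, fun h0 ↦ hq0 ((ho _ h2 h1).symm.trans h0)⟩, h2⟩
  have hcard : ((S.filter fun q' ↦ Quotient.mk (MulAction.orbitRel G T) q' = Quotient.mk _ q).card
      * Nat.card (MulAction.stabilizer G q) : ℕ) = Nat.card (MulAction.stabilizer G p) := by
    rw [← Set.ncard_coe_finset, hfib, ← MulAction.index_stabilizer, mul_comm,
      ← Subgroup.card_mul_index (MulAction.stabilizer (MulAction.stabilizer G p) q)]
    congr 1
    refine Nat.card_congr
      ⟨fun γ ↦ ⟨⟨γ, hstab q hqU γ.2⟩, γ.2⟩, fun γ ↦ ⟨γ.1.1, γ.2⟩, fun _ ↦ rfl, fun _ ↦ rfl⟩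
  rw [Finset.sum_congr rfl fun q' hq' ↦ by
    rw [ho q' (Finset.mem_filter.mp hq').2 ((hmemS q').mp (Finset.mem_filter.mp hq').1).1],
    Finset.sum_const, hm, nsmul_eq_mul]
  have h1 : (Nat.card (MulAction.stabilizer G q) : ℚ) ≠ 0 := by
    exact_mod_cast Nat.card_pos.ne'
  have h2 : (Nat.card (MulAction.stabilizer G p) : ℚ) ≠ 0 := by
    exact_mod_cast Nat.card_pos.ne'
  rw [div_eq_iff h1, mul_div_assoc', div_mul_eq_mul_div, eq_div_iff h2, ← hcard]
  push_cast
  ring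

/-! ### The group Γ₀*(5) in integer coordinates. -/

/-- These are the real and imaginary parts of w(cz + d) = az + b; they turn questions about the
action into polynomial identities. -/
theorem smul_eq_iff (g : SL(2, ℝ)) (z w : ℍ) :
    g • z = w ↔ g.1 0 0 * z.re + g.1 0 1 =
        w.re * (g.1 1 0 * z.re + g.1 1 1) - w.im * (g.1 1 0 * z.im) ∧
      g.1 0 0 * z.im = w.re * (g.1 1 0 * z.im) + w.im * (g.1 1 0 * z.re + g.1 1 1) := by
  have hden : ((g.1 1 0 : ℂ) * (z : ℂ) + (g.1 1 1 : ℂ)) ≠ 0 :=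
    UpperHalfPlane.denom_ne_zero (g : GL (Fin 2) ℝ) z
  have hcoe : ((g • z : ℍ) : ℂ) = (g.1 0 0 * z + g.1 0 1) / (g.1 1 0 * z + g.1 1 1) :=
    UpperHalfPlane.coe_specialLinearGroup_apply g z
  rw [← UpperHalfPlane.coe_inj, hcoe, div_eq_iff hden, Complex.ext_iff]
  simp

theorem im_eq_im_smul_mul (g : SL(2, ℝ)) (z : ℍ) :
    z.im = (g • z).im * ((g.1 1 0 * z.re + g.1 1 1) ^ 2 + (g.1 1 0 * z.im) ^ 2) := by
  obtain ⟨h1, h2⟩ := (smul_eq_iff g z (g • z)).mp rfl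
  have hdet := g.2
  rw [Matrix.det_fin_two] at hdet
  linear_combination (-z.im) * hdet + (g.1 1 0 * z.re + g.1 1 1) * h2 - g.1 1 0 * z.im * h1

/-- The product of (a, b; 5c, d) with W₅ is (√5 b, −a/√5; √5 d, −√5 c), which accounts for the
second shape. -/
theorem mem_Gamma0Star_five {g : SL(2, ℝ)} : g ∈ Gamma0Star 5 ↔ ∃ a b c d : ℤ,
    (a * d - 5 * (b * c) = 1 ∧ g.1 = !![(a : ℝ), (b : ℝ); 5 * c, (d : ℝ)]) ∨
    (5 * (a * d) - b * c = 1 ∧ g.1 = !![√5 * (a : ℝ), (b : ℝ) / √5; √5 * c, √5 * (d : ℝ)]) := by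
  have h5 : √5 * √5 = 5 := Real.mul_self_sqrt (by norm_num)
  have h5' : √5 ≠ 0 := by positivity
  change (g ∈ Gamma0R 5 ∨ ∃ h ∈ Gamma0R 5, g = h * W 5) ↔ _
  constructor
  · rintro (h | ⟨h, hh, rfl⟩)
    · obtain ⟨a, b, c, d, h1, h2⟩ := mem_Gamma0R.mp h
      exact ⟨a, b, c, d, Or.inl ⟨by push_cast at h1; linear_combination h1, by simpa using h2⟩⟩
    · obtain ⟨a, b, c, d, h1, h2⟩ := mem_Gamma0R.mp hh
      refine ⟨b, -a, d, -c, Or.inr ⟨by push_cast at h1; linear_combination h1, ?_⟩⟩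
      rw [Matrix.SpecialLinearGroup.coe_mul, h2]
      ext i j
      fin_cases i <;> fin_cases j <;> simp [W, Matrix.mul_apply, Fin.sum_univ_two] <;> field_simp
      rw [pow_two, h5, mul_comm]
  · rintro ⟨a, b, c, d, ⟨h1, h2⟩ | ⟨h1, h2⟩⟩
    · exact Or.inl (mem_Gamma0R.mpr
        ⟨a, b, c, d, by push_cast; linear_combination h1, by simpa using h2⟩)
    · let h : SL(2, ℝ) := ⟨!![((-b : ℤ) : ℝ), (a : ℝ); (5 : ℕ) * ((-d : ℤ) : ℝ), (c : ℝ)], by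
        rw [Matrix.det_fin_two_of]
        push_cast
        have : (5 * (a * d) - b * c : ℝ) = 1 := by exact_mod_cast h1
        linear_combination this⟩
      refine Or.inr ⟨h, mem_Gamma0R.mpr ⟨-b, a, -d, c, by push_cast; linear_combination h1, rfl⟩, ?_⟩
      apply Subtype.ext
      rw [Matrix.SpecialLinearGroup.coe_mul, h2]
      ext i j
      fin_cases i <;> fin_cases j <;>
        simp [h, W, Matrix.mul_apply, Fin.sum_univ_two] <;> field_simp
      rw [pow_two, h5, mul_comm]

/-- The element `(a, b; 5c, d)` of `Γ₀*(5)`. -/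
def ofGamma0 (a b c d : ℤ) (h : a * d - 5 * (b * c) = 1) : Gamma0Star 5 :=
  ⟨⟨!![(a : ℝ), (b : ℝ); 5 * c, (d : ℝ)], by
    rw [Matrix.det_fin_two_of]
    have : (a * d - 5 * (b * c) : ℝ) = 1 := by exact_mod_cast h
    linear_combination this⟩,
   mem_Gamma0Star_five.mpr ⟨a, b, c, d, Or.inl ⟨h, rfl⟩⟩⟩

/-- The element `√5 (a, b/5; c, d)` of `Γ₀*(5)`. -/
def ofFricke (a b c d : ℤ) (h : 5 * (a * d) - b * c = 1) : Gamma0Star 5 :=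
  ⟨⟨!![√5 * (a : ℝ), (b : ℝ) / √5; √5 * c, √5 * (d : ℝ)], by
    have h5 : √5 * √5 = 5 := Real.mul_self_sqrt (by norm_num)
    have h5' : √5 ≠ 0 := by positivity
    rw [Matrix.det_fin_two_of, mul_mul_mul_comm, h5]
    have : (5 * (a * d) - b * c : ℝ) = 1 := by exact_mod_cast h
    field_simp
    linear_combination this⟩,
   mem_Gamma0Star_five.mpr ⟨a, b, c, d, Or.inr ⟨h, rfl⟩⟩⟩

theorem ofGamma0_smul_eq_iff {a b c d : ℤ} (h : a * d - 5 * (b * c) = 1) (z w : ℍ) :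
    ofGamma0 a b c d h • z = w ↔
      a * z.re + b = w.re * (5 * c * z.re + d) - w.im * (5 * c * z.im) ∧
      a * z.im = w.re * (5 * c * z.im) + w.im * (5 * c * z.re + d) :=
  smul_eq_iff (ofGamma0 a b c d h).1 z w

/-- The common factor √5 of the matrix cancels, leaving rational coefficients. -/
theorem ofFricke_smul_eq_iff {a b c d : ℤ} (h : 5 * (a * d) - b * c = 1) (z w : ℍ) :
    ofFricke a b c d h • z = w ↔
      a * z.re + b / 5 = w.re * (c * z.re + d) - w.im * (c * z.im) ∧
      a * z.im = w.re * (c * z.im) + w.im * (c * z.re + d) := by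
  have h5 : √5 * √5 = 5 := Real.mul_self_sqrt (by norm_num)
  have h5' : √5 ≠ 0 := by positivity
  have hb : (b : ℝ) / √5 = √5 * (b / 5) := by
    field_simp
    linear_combination -(b : ℝ) * h5
  refine (smul_eq_iff (ofFricke a b c d h).1 z w).trans ?_
  have e00 : (ofFricke a b c d h).1.1 0 0 = √5 * a := rfl
  have e01 : (ofFricke a b c d h).1.1 0 1 = √5 * (b / 5) := hb
  have e10 : (ofFricke a b c d h).1.1 1 0 = √5 * c := rfl
  have e11 : (ofFricke a b c d h).1.1 1 1 = √5 * d := rfl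
  rw [e00, e01, e10, e11, ← mul_right_inj' h5' (b := a * z.re + b / 5),
    ← mul_right_inj' h5' (b := a * z.im)]
  constructor <;> rintro ⟨h1, h2⟩ <;> constructor <;> linarith

/-- Translations belong to `Γ₀*(5)`. -/
def translation (n : ℤ) : Gamma0Star 5 := ofGamma0 1 n 0 1 (by ring)

theorem translation_smul_eq_iff (n : ℤ) (z w : ℍ) :
    translation n • z = w ↔ z.re + n = w.re ∧ z.im = w.im := by
  rw [translation, ofGamma0_smul_eq_iff]
  simp

theorem coe_translation_smul (n : ℤ) (z : ℍ) : ((translation n • z : ℍ) : ℂ) = z + n := by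
  obtain ⟨h1, h2⟩ := (translation_smul_eq_iff n z _).mp rfl
  apply Complex.ext
  · simpa using h1.symm
  · simpa using h2.symm

theorem cls_eq_iff {z w : ℍ} : cls z = cls w ↔ ∃ γ : Gamma0Star 5, γ • w = z :=
  Quotient.eq

theorem cls_smul (γ : Gamma0Star 5) (z : ℍ) : cls (γ • z) = cls z :=
  cls_eq_iff.mpr ⟨γ, rfl⟩

/-! ### Proper discontinuity and reduction theory. -/

/-- This is inherited from SL₂(ℤ): `h * W 5` carries a point of `K` into `L` exactly when `h`
carries a point of `W 5 • K` into `L`. -/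
instance : ProperlyDiscontinuousSMul (Gamma0Star 5) ℍ := by
  have h0 : ProperlyDiscontinuousSMul
      (Matrix.SpecialLinearGroup.map (n := Fin 2) (Int.castRingHom ℝ)).range ℍ := inferInstance
  rw [Subgroup.properlyDiscontinuousSMul_iff] at h0 ⊢
  have hle : ∀ g ∈ Gamma0R 5,
      g ∈ (Matrix.SpecialLinearGroup.map (n := Fin 2) (Int.castRingHom ℝ)).range := by
    rintro _ ⟨A, -, rfl⟩
    exact ⟨A, rfl⟩
  intro K L hK hL
  have hWK : IsCompact (W 5 • K) := hK.image (continuous_const_smul (W 5))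
  refine ((h0 hK hL).union ((h0 hWK hL).image fun h ↦ h * W 5)).subset ?_
  rintro g ⟨hg | ⟨h, hh, rfl⟩, hne⟩
  · exact Or.inl ⟨hle g hg, hne⟩
  · exact Or.inr ⟨h, ⟨hle h hh, by rwa [smul_smul]⟩, rfl⟩

/-- Every orbit of `Γ₀*(5)` meets the half plane `Im z ≥ √3 / 10`. -/
theorem exists_le_im_smul (z : ℍ) : ∃ γ : Gamma0Star 5, 3 ≤ 100 * (γ • z).im ^ 2 := by
  obtain ⟨g, hg⟩ := ModularGroup.exists_smul_mem_fd z
  have him := ModularGroup.three_le_four_mul_im_sq_of_mem_fd hg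
  set w := g • z with hw
  have hw' : (Matrix.SpecialLinearGroup.map (Int.castRingHom ℝ) g) • z = w := rfl
  rw [smul_eq_iff] at hw'
  simp only [Matrix.SpecialLinearGroup.map_apply_coe, RingHom.mapMatrix_apply, Matrix.map_apply,
    eq_intCast] at hw'
  have hdet := g.2
  rw [Matrix.det_fin_two] at hdet
  generalize g.1 0 0 = a at hw' hdet
  generalize g.1 0 1 = b at hw' hdet
  generalize g.1 1 0 = c at hw' hdet
  generalize g.1 1 1 = d at hw' hdet
  obtain ⟨h1, h2⟩ := hw'
  by_cases hc : (5 : ℤ) ∣ c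
  · obtain ⟨c, rfl⟩ := hc
    push_cast at h1 h2
    refine ⟨ofGamma0 a b c d (by linear_combination hdet), ?_⟩
    rw [(ofGamma0_smul_eq_iff _ z w).mpr ⟨h1, h2⟩]
    nlinarith
  -- Here `c` is invertible mod 5, so `j` can be chosen with 5 ∣ a + jc. Then z ↦ (w + j)/5 is given
  -- by an element of Γ₀(5)W₅, and the height √3/2 of the SL₂(ℤ)-domain drops only to √3/10.
  · obtain ⟨j, hj⟩ : ∃ j : ℤ, (5 : ℤ) ∣ a + j * c := by
      have hcop : IsCoprime (5 : ℤ) c := (Int.prime_iff_natAbs_prime.mpr (by norm_num)).coprime_iff_not_dvd.mpr hc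
      obtain ⟨u, v, huv⟩ := hcop
      exact ⟨-(a * v), a * u, by linear_combination (-a) * huv⟩
    obtain ⟨e, he⟩ := hj
    have he' : (a + j * c : ℝ) = 5 * e := by exact_mod_cast he
    refine ⟨ofFricke e (b + j * d) c d (by linear_combination hdet - d * he), ?_⟩
    let w' : ℍ := ⟨⟨(w.re + j) / 5, w.im / 5⟩, div_pos w.im_pos (by norm_num)⟩
    have hre : w'.re = (w.re + j) / 5 := rfl
    have him' : w'.im = w.im / 5 := rfl
    rw [(ofFricke_smul_eq_iff _ z w').mpr, him']
    · nlinarith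
    · rw [hre, him']
      push_cast
      constructor
      · linear_combination (1 / 5 : ℝ) * h1 - z.re / 5 * he'
      · linear_combination (1 / 5 : ℝ) * h2 - z.im / 5 * he'

theorem exists_abs_re_le (z : ℍ) :
    ∃ γ : Gamma0Star 5, |(γ • z).re| ≤ 1 / 2 ∧ 3 ≤ 100 * (γ • z).im ^ 2 := by
  obtain ⟨γ, hγ⟩ := exists_le_im_smul z
  obtain ⟨h1, h2⟩ := (translation_smul_eq_iff (-round (γ • z).re) (γ • z) _).mp rfl
  refine ⟨translation (-round (γ • z).re) * γ, ?_⟩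
  rw [mul_smul, ← h1, ← h2]
  refine ⟨?_, hγ⟩
  push_cast
  rw [← sub_eq_add_neg]
  exact abs_sub_round _

theorem one_le_sq_of_ne_zero {c : ℤ} (hc : c ≠ 0) : (1 : ℝ) ≤ (c : ℝ) ^ 2 := by
  have : (1 : ℤ) ≤ c ^ 2 := Int.add_one_le_iff.mpr
    ((sq_nonneg c).lt_of_ne (pow_ne_zero 2 hc).symm)
  exact_mod_cast this

/-- From Im(gz) = Im z / |cz + d|² and |cz + d|² ≥ c² (Im z)² ≥ 5 (Im z)². -/
theorem im_smul_mul_im_le {g : SL(2, ℝ)} (hg : 5 ≤ g.1 1 0 ^ 2) (z : ℍ) :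
    (g • z).im * z.im ≤ 1 / 5 := by
  have him := im_eq_im_smul_mul g z
  have h1 := z.im_pos
  have h2 := (g • z).im_pos
  have h3 : (g • z).im * (5 * z.im ^ 2) ≤ z.im := by
    conv_rhs => rw [him]
    gcongr
    nlinarith [sq_nonneg (g.1 1 0 * z.re + g.1 1 1), sq_nonneg z.im]
  have h4 : z.im * ((g • z).im * z.im * 5) ≤ z.im * 1 := by linarith
  linarith [le_of_mul_le_mul_left h4 h1]

/-- An element of `Γ₀*(5)` is up to sign a translation, or moves points of large height far down. -/
theorem eq_translation_or_im_le (γ : Gamma0Star 5) (z : ℍ) :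
    (∃ n : ℤ, ∀ w : ℍ, γ • w = translation n • w) ∨ (γ • z).im * z.im ≤ 1 / 5 := by
  obtain ⟨a, b, c, d, ⟨hdet, hγ⟩ | ⟨hdet, hγ⟩⟩ := mem_Gamma0Star_five.mp γ.2
  · obtain rfl : γ = ofGamma0 a b c d hdet := Subtype.ext (Subtype.ext hγ)
    by_cases hc : c = 0
    · subst hc
      have h0 : a * d = 1 := by linear_combination hdet
      rcases Int.mul_eq_one_iff_eq_one_or_neg_one.mp h0 with ⟨rfl, rfl⟩ | ⟨rfl, rfl⟩
      · refine Or.inl ⟨b, fun w ↦ ?_⟩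
        obtain ⟨h1, h2⟩ := (translation_smul_eq_iff b w _).mp rfl
        rw [ofGamma0_smul_eq_iff]
        push_cast
        constructor <;> linarith
      · refine Or.inl ⟨-b, fun w ↦ ?_⟩
        obtain ⟨h1, h2⟩ := (translation_smul_eq_iff (-b) w _).mp rfl
        rw [ofGamma0_smul_eq_iff]
        push_cast at h1 ⊢
        constructor <;> linarith
    · right
      refine im_smul_mul_im_le (g := (ofGamma0 a b c d hdet).1) ?_ z
      change (5 : ℝ) ≤ (5 * c) ^ 2
      nlinarith [one_le_sq_of_ne_zero hc]
  · obtain rfl : γ = ofFricke a b c d hdet := Subtype.ext (Subtype.ext hγ)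
    have hc : c ≠ 0 := by
      rintro rfl
      omega
    right
    refine im_smul_mul_im_le (g := (ofFricke a b c d hdet).1) ?_ z
    change (5 : ℝ) ≤ (√5 * c) ^ 2
    rw [mul_pow, Real.sq_sqrt (by norm_num)]
    linarith [one_le_sq_of_ne_zero hc]

/-! ### Stabilizers and elliptic points. -/

/-- The elements of `Γ₀*(5)` fixing a point are `±1` and elements of trace zero. -/
theorem eq_one_or_trace_eq_zero {γ : Gamma0Star 5} {z : ℍ} (h : γ • z = z) :
    γ.1 = 1 ∨ γ.1 = -1 ∨ (γ.1.1 1 1 = -γ.1.1 0 0 ∧ γ.1.1 0 0 = γ.1.1 1 0 * z.re ∧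
      (γ.1.1 1 0 * z.im) ^ 2 = 1 ∧
      γ.1.1 0 1 = -(γ.1.1 1 0 * (z.re ^ 2 + z.im ^ 2))) := by
  obtain ⟨h1, h2⟩ := (smul_eq_iff γ.1 z z).mp h
  have hdet := γ.1.2
  rw [Matrix.det_fin_two] at hdet
  have hy := z.im_pos
  have h3 : γ.1.1 0 0 - γ.1.1 1 1 = 2 * γ.1.1 1 0 * z.re := by
    refine mul_right_cancel₀ hy.ne' ?_
    linear_combination h2
  have h01 : γ.1.1 0 1 = -(γ.1.1 1 0 * (z.re ^ 2 + z.im ^ 2)) := by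
    linear_combination h1 - z.re * h3
  have h4 : (γ.1.1 0 0 + γ.1.1 1 1) ^ 2 + 4 * (γ.1.1 1 0 * z.im) ^ 2 = 4 := by
    rw [h01] at hdet
    linear_combination 4 * hdet + (γ.1.1 0 0 - γ.1.1 1 1 + 2 * γ.1.1 1 0 * z.re) * h3
  -- By `h4` the trace is at most 2 in absolute value. On Γ₀(5) it is an integer t, and t = ±1 is
  -- impossible: a² − ta + 1 ≡ 0 mod 5 has discriminant −3, a non-residue. On the other coset it is
  -- √5(a + d), which must vanish.
  have key : γ.1.1 0 0 + γ.1.1 1 1 = 0 ∨ (γ.1.1 0 0 + γ.1.1 1 1) ^ 2 = 4 := by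
    obtain ⟨a, b, c, d, ⟨hd, hγ⟩ | ⟨hd, hγ⟩⟩ := mem_Gamma0Star_five.mp γ.2
    · rw [hγ] at h4 ⊢
      have h5 : ((a + d) ^ 2 : ℝ) ≤ 4 := by
        have : (((a : ℝ) + d) ^ 2) + 4 * (5 * c * z.im) ^ 2 = 4 := h4
        nlinarith [sq_nonneg (5 * c * z.im)]
      have h6 : (a + d) ^ 2 ≤ 4 := by exact_mod_cast h5
      have h7 : a + d ≤ 2 := by nlinarith
      have h8 : -2 ≤ a + d := by nlinarith
      change (a : ℝ) + d = 0 ∨ ((a : ℝ) + d) ^ 2 = 4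
      obtain ⟨t, ht⟩ : ∃ t, a + d = t := ⟨_, rfl⟩
      have ht' : (a : ℝ) + d = t := by exact_mod_cast ht
      rw [ht']
      rw [ht] at h7 h8
      obtain rfl : d = t - a := by omega
      have hmod : (a * (t - a)) % 5 = 1 := by omega
      have ha : a % 5 = 0 ∨ a % 5 = 1 ∨ a % 5 = 2 ∨ a % 5 = 3 ∨ a % 5 = 4 := by omega
      interval_cases t
      · right; norm_num
      · exfalso
        rcases ha with ha | ha | ha | ha | ha <;> simp [Int.mul_emod, Int.sub_emod, ha] at hmod
      · left; norm_num
      · exfalso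
        rcases ha with ha | ha | ha | ha | ha <;> simp [Int.mul_emod, Int.sub_emod, ha] at hmod
      · right; norm_num
    · left
      rw [hγ] at h4 ⊢
      change √5 * (a : ℝ) + √5 * d = 0
      have h5 : (5 * (a + d) ^ 2 : ℝ) ≤ 4 := by
        have : (√5 * (a : ℝ) + √5 * d) ^ 2 + 4 * (√5 * c * z.im) ^ 2 = 4 := h4
        rw [← mul_add, mul_pow, Real.sq_sqrt (by norm_num)] at this
        nlinarith [sq_nonneg (√5 * c * z.im)]
      have h6 : 5 * (a + d) ^ 2 ≤ 4 := by exact_mod_cast h5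
      have h7 : a + d < 1 := by nlinarith
      have h8 : -1 < a + d := by nlinarith
      have h9 : a + d = 0 := by omega
      rw [← mul_add, ← Int.cast_add, h9]
      simp
  rcases key with h0 | h0
  · refine Or.inr (Or.inr ⟨by linarith, by linarith, ?_, h01⟩)
    rw [h0] at h4
    linarith
  · have hc : γ.1.1 1 0 = 0 := by
      have : (γ.1.1 1 0 * z.im) ^ 2 = 0 := by linarith
      simpa [hy.ne'] using this
    rw [hc] at h3 h01
    have h11 : γ.1.1 1 1 = γ.1.1 0 0 := by linarith
    have h01' : γ.1.1 0 1 = 0 := by linarith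
    rw [hc, h11, mul_zero, sub_zero, mul_self_eq_one_iff] at hdet
    refine hdet.imp (fun h00 ↦ ?_) fun h00 ↦ Or.inl ?_
    · refine Subtype.ext ?_
      ext i j
      fin_cases i <;> fin_cases j <;> simp [hc, h11, h01', h00]
    · refine Subtype.ext ?_
      rw [Matrix.SpecialLinearGroup.coe_neg]
      ext i j
      fin_cases i <;> fin_cases j <;> simp [hc, h11, h01', h00]

theorem neg_one_mem : (-1 : SL(2, ℝ)) ∈ Gamma0Star 5 :=
  Or.inl (neg_mem (one_mem _))

theorem one_ne_neg_one : (1 : SL(2, ℝ)) ≠ -1 := by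
  intro h
  have : (1 : SL(2, ℝ)).1 0 0 = (-1 : SL(2, ℝ)).1 0 0 := by rw [← h]
  rw [Matrix.SpecialLinearGroup.coe_neg] at this
  simp at this
  norm_num at this

theorem neg_smul' (g : SL(2, ℝ)) (z : ℍ) : (-g) • z = g • z := by
  obtain ⟨h1, h2⟩ := (smul_eq_iff g z _).mp rfl
  rw [smul_eq_iff]
  simp only [Matrix.SpecialLinearGroup.coe_neg, Matrix.neg_apply]
  constructor <;> linarith

theorem card_stabilizer_eq_ncard (z : ℍ) : Nat.card (MulAction.stabilizer (Gamma0Star 5) z) =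
    {g : SL(2, ℝ) | g ∈ Gamma0Star 5 ∧ g • z = z}.ncard := by
  rw [← Nat.card_coe_set_eq]
  exact Nat.card_congr ⟨fun γ ↦ ⟨γ.1.1, γ.1.2, γ.2⟩, fun g ↦ ⟨⟨g.1, g.2.1⟩, g.2.2⟩,
    fun _ ↦ rfl, fun _ ↦ rfl⟩

theorem card_stabilizer_eq_two {z : ℍ}
    (h : ∀ γ : Gamma0Star 5, γ • z = z → γ.1 = 1 ∨ γ.1 = -1) :
    Nat.card (MulAction.stabilizer (Gamma0Star 5) z) = 2 := by
  refine (card_stabilizer_eq_ncard z).trans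
    (Eq.trans (congrArg Set.ncard ?_) (Set.ncard_pair one_ne_neg_one))
  ext g
  simp only [Set.mem_ofPred_eq, Set.mem_insert_iff, Set.mem_singleton_iff]
  constructor
  · exact fun hg ↦ h ⟨g, hg.1⟩ hg.2
  · rintro (rfl | rfl)
    · exact ⟨one_mem _, one_smul _ _⟩
    · exact ⟨neg_one_mem, by rw [neg_smul', one_smul]⟩

/-- A trace-zero element fixing z is determined by its lower left entry c, and (c Im z)² = 1 leaves
two opposite values. So besides ±1 there are only ±γ. -/
theorem card_stabilizer_eq_four {z : ℍ} {γ : Gamma0Star 5} (h : γ • z = z) (h1 : γ.1 ≠ 1)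
    (h2 : γ.1 ≠ -1) : Nat.card (MulAction.stabilizer (Gamma0Star 5) z) = 4 := by
  have hset : {g : SL(2, ℝ) | g ∈ Gamma0Star 5 ∧ g • z = z} = {1, -1, γ.1, -γ.1} := by
    ext g
    simp only [Set.mem_ofPred_eq, Set.mem_insert_iff, Set.mem_singleton_iff]
    constructor
    · rintro ⟨hg, hgz⟩
      rcases eq_one_or_trace_eq_zero (γ := ⟨g, hg⟩) hgz with h0 | h0 | ⟨a1, a2, a3, a4⟩
      · exact Or.inl h0
      · exact Or.inr (Or.inl h0)
      rcases eq_one_or_trace_eq_zero h with h0 | h0 | ⟨b1, b2, b3, b4⟩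
      · exact absurd h0 h1
      · exact absurd h0 h2
      refine Or.inr (Or.inr ?_)
      dsimp only at a1 a2 a3 a4
      have hs : (g.1 1 0 * z.im) ^ 2 = (γ.1.1 1 0 * z.im) ^ 2 := by rw [a3, b3]
      rw [mul_pow, mul_pow, mul_left_inj' (pow_ne_zero 2 z.im_ne_zero), sq_eq_sq_iff_eq_or_eq_neg]
        at hs
      refine hs.imp (fun hs ↦ ?_) fun hs ↦ ?_
      · refine Subtype.ext ?_
        ext i j
        fin_cases i <;> fin_cases j <;> simp [a1, a2, a4, b1, b2, b4, hs]
      · refine Subtype.ext ?_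
        rw [Matrix.SpecialLinearGroup.coe_neg]
        ext i j
        fin_cases i <;> fin_cases j <;> simp [a1, a2, a4, b1, b2, b4, hs]
    · rintro (rfl | rfl | rfl | rfl)
      · exact ⟨one_mem _, one_smul _ _⟩
      · exact ⟨neg_one_mem, by rw [neg_smul', one_smul]⟩
      · exact ⟨γ.2, h⟩
      · exact ⟨neg_one_mul γ.1 ▸ mul_mem neg_one_mem γ.2, by rw [neg_smul']; exact h⟩
  have h3 : γ.1 ≠ -γ.1 := by
    intro h0
    have : γ.1.1 1 0 = (-γ.1).1 1 0 := by rw [← h0]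
    rw [Matrix.SpecialLinearGroup.coe_neg, Matrix.neg_apply] at this
    rcases eq_one_or_trace_eq_zero h with h0 | h0 | ⟨b1, b2, b3, b4⟩
    · exact h1 h0
    · exact h2 h0
    · rw [show γ.1.1 1 0 = 0 by linarith] at b3
      norm_num at b3
  rw [card_stabilizer_eq_ncard, hset, Set.ncard_insert_of_notMem, Set.ncard_insert_of_notMem,
    Set.ncard_pair h3]
  · simp only [Set.mem_insert_iff, Set.mem_singleton_iff, not_or]
    exact ⟨h2.symm, fun h0 ↦ h1 (neg_injective h0).symm⟩
  · simp only [Set.mem_insert_iff, Set.mem_singleton_iff, not_or]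
    exact ⟨one_ne_neg_one, h1.symm, fun h0 ↦ h2 (by rw [h0, neg_neg])⟩

/-- The elliptic points of `Γ₀*(5)`. -/
theorem cls_eq_of_smul_eq {γ : Gamma0Star 5} {z : ℍ} (h : γ • z = z) (h1 : γ.1 ≠ 1)
    (h2 : γ.1 ≠ -1) : cls z = cls iDivSqrtFive ∨ cls z = cls rho51 ∨ cls z = cls rho52 := by
  obtain ⟨δ, hδ⟩ := exists_le_im_smul z
  rw [← cls_smul δ z]
  set w := δ • z with hw
  set η := δ * γ * δ⁻¹ with hη
  have hηw : η • w = w := by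
    rw [hη, hw, mul_smul, mul_smul, inv_smul_smul, h]
  have hconj : γ = δ⁻¹ * η * δ := by rw [hη]; group
  have hη1 : η.1 ≠ 1 := fun h0 ↦ h1 (by
    rw [hconj, Subgroup.coe_mul, Subgroup.coe_mul, h0, mul_one, Subgroup.coe_inv, inv_mul_cancel])
  have hη2 : η.1 ≠ -1 := fun h0 ↦ h2 (by
    rw [hconj, Subgroup.coe_mul, Subgroup.coe_mul, h0, mul_neg_one, neg_mul, Subgroup.coe_inv,
      inv_mul_cancel])
  obtain ⟨a1, a2, a3, a4⟩ := ((eq_one_or_trace_eq_zero hηw).resolve_left hη1).resolve_left hη2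
  have hy := w.im_pos
  clear_value w η
  obtain ⟨a, b, c, d, ⟨hd, hγ⟩ | ⟨hd, hγ⟩⟩ := mem_Gamma0Star_five.mp η.2
  · simp only [hγ] at a1 a2 a3 a4
    replace a1 : (d : ℝ) = -a := a1
    replace a2 : (a : ℝ) = 5 * c * w.re := a2
    replace a3 : (5 * (c : ℝ) * w.im) ^ 2 = 1 := a3
    obtain rfl : d = -a := by exact_mod_cast a1
    -- From 25 c² (Im w)² = 1 and (Im w)² ≥ 3/100.
    have hc : (c : ℝ) ^ 2 < 2 := by nlinarith [sq_nonneg (c : ℝ)]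
    have hc' : c ^ 2 < 2 := by exact_mod_cast hc
    have hc0 : c ≠ 0 := by
      rintro rfl
      norm_num at a3
    have hc1 : c = 1 ∨ c = -1 := by
      have : c ≤ 1 := by nlinarith
      have : -1 ≤ c := by nlinarith
      omega
    -- The determinant gives a² ≡ −1 mod 5, so `e` is ±2 mod 5.
    obtain ⟨e, he, hre⟩ : ∃ e : ℤ, e ^ 2 % 5 = 4 ∧ w.re = e / 5 := by
      rcases hc1 with rfl | rfl
      · exact ⟨a, by rw [pow_two]; have : a * -a = -(a * a) := by ring
                     omega, by push_cast at a2; linarith⟩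
      · exact ⟨-a, by rw [pow_two, neg_mul_neg]; have : a * -a = -(a * a) := by ring
                      omega, by push_cast at a2 ⊢; linarith⟩
    have him : w.im = 1 / 5 := by
      have : (5 * w.im - 1) * (5 * w.im + 1) = 0 := by
        rcases hc1 with rfl | rfl <;> push_cast at a3 <;> linear_combination a3
      rcases mul_eq_zero.mp this with h0 | h0 <;> linarith
    have he5 : e % 5 = 0 ∨ e % 5 = 1 ∨ e % 5 = 2 ∨ e % 5 = 3 ∨ e % 5 = 4 := by omega
    have hρre : rho52.re = -2 / 5 := rfl
    have hρim : rho52.im = 1 / 5 := rfl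
    refine Or.inr (Or.inr ?_)
    rcases he5 with h5 | h5 | h5 | h5 | h5
    · simp [pow_two, Int.mul_emod, h5] at he
    · simp [pow_two, Int.mul_emod, h5] at he
    · obtain ⟨n, rfl⟩ : ∃ n, e = 5 * n + 2 := ⟨e / 5, by omega⟩
      -- The Fricke involution z ↦ −1/(5z) sends −2/5 + i/5 to 2/5 + i/5, which merges the two
      -- residue classes.
      have hv : ofFricke 0 (-1) 1 0 (by norm_num) • rho52 = translation (-n) • w := by
        rw [ofFricke_smul_eq_iff]
        obtain ⟨t1, t2⟩ := (translation_smul_eq_iff (-n) w _).mp rfl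
        rw [← t1, ← t2, hre, him, hρre, hρim]
        push_cast
        constructor <;> ring
      rw [← cls_smul (translation (-n)) w, ← hv, cls_smul]
    · obtain ⟨n, rfl⟩ : ∃ n, e = 5 * n - 2 := ⟨(e + 2) / 5, by omega⟩
      have hv : translation n • rho52 = w := by
        rw [translation_smul_eq_iff, hre, him, hρre, hρim]
        push_cast
        exact ⟨by ring, rfl⟩
      rw [← hv, cls_smul]
    · simp [pow_two, Int.mul_emod, h5] at he
  · simp only [hγ] at a1 a2 a3 a4
    have h5 : √5 ^ 2 = 5 := Real.sq_sqrt (by norm_num)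
    have h5p : 0 < √5 := by positivity
    replace a1 : √5 * (d : ℝ) = -(√5 * a) := a1
    replace a2 : √5 * (a : ℝ) = √5 * c * w.re := a2
    replace a3 : (√5 * (c : ℝ) * w.im) ^ 2 = 1 := a3
    rw [← mul_neg, mul_right_inj' h5p.ne'] at a1
    rw [mul_assoc, mul_right_inj' h5p.ne'] at a2
    obtain rfl : d = -a := by exact_mod_cast a1
    have a3' : 5 * (c : ℝ) ^ 2 * w.im ^ 2 = 1 := by
      rw [mul_pow, mul_pow, h5] at a3
      exact a3
    -- From 5 c² (Im w)² = 1 one gets c² ≤ 20/3. The values c = ±1 lead to i/√5 and c = ±2 to ρ₅,₁.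
    have hc : (c : ℝ) ^ 2 < 9 := by nlinarith [sq_nonneg (c : ℝ)]
    have hc' : c ^ 2 < 9 := by exact_mod_cast hc
    have hc0 : c ≠ 0 := by
      rintro rfl
      norm_num at a3
    have hcc : (c = 1 ∨ c = -1) ∨ (c = 2 ∨ c = -2) := by
      have : c < 3 := by nlinarith
      have : -3 < c := by nlinarith
      omega
    rcases hcc with hc1 | hc2
    · left
      have hre : ∃ n : ℤ, w.re = n := by
        rcases hc1 with rfl | rfl
        · exact ⟨a, by push_cast at a2; linarith⟩
        · exact ⟨-a, by push_cast at a2 ⊢; linarith⟩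
      obtain ⟨n, hre⟩ := hre
      have him : w.im = 1 / √5 := by
        rw [eq_div_iff h5p.ne', ← sq_eq_sq₀ (by positivity) one_pos.le, mul_pow, h5]
        rcases hc1 with rfl | rfl <;> push_cast at a3' <;> linarith
      have hv : translation n • iDivSqrtFive = w := by
        rw [translation_smul_eq_iff, hre, him]
        exact ⟨zero_add _, rfl⟩
      rw [← hv, cls_smul]
    · right
      left
      have hre : ∃ n : ℤ, w.re = n - 1 / 2 := by
        -- With c = ±2, the relation −5a² − bc = 1 forces a to be odd, so a/c is a half-integer.
        have hodd : ∃ m, a = 2 * m + 1 := by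
          have h6 : a * a % 2 = 1 := by
            have : a * -a = -(a * a) := by ring
            rcases hc2 with rfl | rfl <;> omega
          have : a % 2 = 0 ∨ a % 2 = 1 := by omega
          rcases this with h7 | h7
          · simp [Int.mul_emod, h7] at h6
          · exact ⟨a / 2, by omega⟩
        obtain ⟨m, rfl⟩ := hodd
        rcases hc2 with rfl | rfl
        · exact ⟨m + 1, by push_cast at a2 ⊢; linarith⟩
        · exact ⟨-m, by push_cast at a2 ⊢; linarith⟩
      obtain ⟨n, hre⟩ := hre
      have him : w.im = 1 / (2 * √5) := by
        rw [eq_div_iff (by positivity), ← sq_eq_sq₀ (by positivity) one_pos.le, mul_pow, mul_pow, h5]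
        rcases hc2 with rfl | rfl <;> push_cast at a3' <;> linarith
      have hv : translation n • rho51 = w := by
        rw [translation_smul_eq_iff, hre, him]
        exact ⟨by change -1 / 2 + (n : ℝ) = _; ring, rfl⟩
      rw [← hv, cls_smul]

theorem card_stabilizer_eq_of_cls_eq {z w : ℍ} (h : cls z = cls w) :
    Nat.card (MulAction.stabilizer (Gamma0Star 5) z) =
      Nat.card (MulAction.stabilizer (Gamma0Star 5) w) :=
  Nat.card_congr (MulAction.stabilizerEquivStabilizerOfOrbitRel (Quotient.exact h)).toEquiv

theorem card_stabilizer_eq_four_of_cls {z : ℍ}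
    (h : cls z = cls iDivSqrtFive ∨ cls z = cls rho51 ∨ cls z = cls rho52) :
    Nat.card (MulAction.stabilizer (Gamma0Star 5) z) = 4 := by
  have h5 : √5 ^ 2 = 5 := Real.sq_sqrt (by norm_num)
  have h5p : 0 < √5 := by positivity
  have hne : ∀ g : SL(2, ℝ), g.1 1 0 ≠ 0 → g ≠ 1 ∧ g ≠ -1 := by
    refine fun g hg ↦ ⟨?_, ?_⟩ <;> rintro rfl
    · exact hg rfl
    · rw [Matrix.SpecialLinearGroup.coe_neg] at hg
      exact hg neg_zero
  -- Each point is fixed by an explicit trace-zero element: W₅, √5(−1, −3/5; 2, 1) and (−2, −1; 5,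
  -- 2). Their nonzero lower left entries distinguish them from ±1.
  rcases h with h | h | h <;> rw [card_stabilizer_eq_of_cls_eq h]
  · have := hne (ofFricke 0 (-1) 1 0 (by norm_num)).1
      (show √5 * ((1 : ℤ) : ℝ) ≠ 0 by positivity)
    refine card_stabilizer_eq_four ((ofFricke_smul_eq_iff _ _ _).mpr ?_) this.1 this.2
    have hre : iDivSqrtFive.re = 0 := rfl
    have him : iDivSqrtFive.im = 1 / √5 := rfl
    rw [hre, him]
    field_simp
    rw [h5]
    norm_num
  · have := hne (ofFricke (-1) (-3) 2 1 (by norm_num)).1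
      (show √5 * ((2 : ℤ) : ℝ) ≠ 0 by positivity)
    refine card_stabilizer_eq_four ((ofFricke_smul_eq_iff _ _ _).mpr ?_) this.1 this.2
    have hre : rho51.re = -1 / 2 := rfl
    have him : rho51.im = 1 / (2 * √5) := rfl
    rw [hre, him]
    push_cast
    field_simp
    rw [h5]
    norm_num
  · have := hne (ofGamma0 (-2) (-1) 1 2 (by norm_num)).1
      (show 5 * ((1 : ℤ) : ℝ) ≠ 0 by norm_num)
    refine card_stabilizer_eq_four ((ofGamma0_smul_eq_iff _ _ _).mpr ?_) this.1 this.2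
    have hre : rho52.re = -2 / 5 := rfl
    have him : rho52.im = 1 / 5 := rfl
    rw [hre, him]
    norm_num

theorem card_stabilizer_eq_two_of_cls {z : ℍ}
    (h : ¬(cls z = cls iDivSqrtFive ∨ cls z = cls rho51 ∨ cls z = cls rho52)) :
    Nat.card (MulAction.stabilizer (Gamma0Star 5) z) = 2 := by
  refine card_stabilizer_eq_two fun γ hγ ↦ ?_
  by_contra! hne
  exact h (cls_eq_of_smul_eq hγ hne.1 hne.2)

theorem sqrt_five_ne_intCast (N : ℤ) : √5 ≠ N := by
  have := (Nat.Prime.irrational_sqrt (p := 5) (by norm_num)).ne_int N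
  exact_mod_cast this

/-- The three orbits are separated by heights: Im z / Im γz = |cz + d|² is a value of a quadratic
form. Here 2 = d² + 5c² and 2 = 5d² + c² have no integer solution; for the other two pairs √5,
respectively 2√5, would be an integer. -/
theorem cls_iDivSqrtFive_ne_rho51 : cls iDivSqrtFive ≠ cls rho51 := by
  intro h
  obtain ⟨γ, hγ⟩ := cls_eq_iff.mp h.symm
  have h5 : √5 ^ 2 = 5 := Real.sq_sqrt (by norm_num)
  have h5p : 0 < √5 := by positivity
  have him := im_eq_im_smul_mul γ.1 iDivSqrtFive
  rw [show γ.1 • iDivSqrtFive = rho51 from hγ, show iDivSqrtFive.im = 1 / √5 from rfl,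
    show iDivSqrtFive.re = 0 from rfl, show rho51.im = 1 / (2 * √5) from rfl] at him
  obtain ⟨a, b, c, d, ⟨hd, hγ⟩ | ⟨hd, hγ⟩⟩ := mem_Gamma0Star_five.mp γ.2 <;> rw [hγ] at him
  · replace him : 1 / √5 = 1 / (2 * √5) * ((5 * c * 0 + d) ^ 2 + (5 * c * (1 / √5)) ^ 2) := him
    rw [mul_pow, div_pow, h5] at him
    field_simp at him
    have h1 : (2 : ℝ) = d ^ 2 + 5 * c ^ 2 := by linarith
    have h2 : 2 = d ^ 2 + 5 * c ^ 2 := by exact_mod_cast h1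
    have h3 : d < 2 := by nlinarith
    have h4 : -2 < d := by nlinarith
    interval_cases d <;> omega
  · replace him : 1 / √5 = 1 / (2 * √5) *
      ((√5 * c * 0 + √5 * d) ^ 2 + (√5 * c * (1 / √5)) ^ 2) := him
    field_simp at him
    rw [h5] at him
    have h1 : (2 : ℝ) = 5 * d ^ 2 + c ^ 2 := by linarith
    have h2 : 2 = 5 * d ^ 2 + c ^ 2 := by exact_mod_cast h1
    have h3 : c < 2 := by nlinarith
    have h4 : -2 < c := by nlinarith
    interval_cases c <;> omega

theorem cls_iDivSqrtFive_ne_rho52 : cls iDivSqrtFive ≠ cls rho52 := by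
  intro h
  obtain ⟨γ, hγ⟩ := cls_eq_iff.mp h.symm
  have h5 : √5 ^ 2 = 5 := Real.sq_sqrt (by norm_num)
  have h5p : 0 < √5 := by positivity
  have him := im_eq_im_smul_mul γ.1 iDivSqrtFive
  rw [show γ.1 • iDivSqrtFive = rho52 from hγ, show iDivSqrtFive.im = 1 / √5 from rfl,
    show iDivSqrtFive.re = 0 from rfl, show rho52.im = 1 / 5 from rfl] at him
  obtain ⟨a, b, c, d, ⟨hd, hγ⟩ | ⟨hd, hγ⟩⟩ := mem_Gamma0Star_five.mp γ.2 <;> rw [hγ] at him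
  · replace him : 1 / √5 = 1 / 5 * ((5 * c * 0 + d) ^ 2 + (5 * c * (1 / √5)) ^ 2) := him
    rw [mul_pow, div_pow, h5, div_eq_iff h5p.ne'] at him
    refine sqrt_five_ne_intCast (d ^ 2 + 5 * c ^ 2) ?_
    push_cast
    linear_combination √5 * him + 1 / 5 * (d ^ 2 + 5 * c ^ 2) * h5
  · replace him : 1 / √5 = 1 / 5 * ((√5 * c * 0 + √5 * d) ^ 2 + (√5 * c * (1 / √5)) ^ 2) := him
    rw [show √5 * c * (1 / √5) = c by field_simp, div_eq_iff h5p.ne'] at him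
    refine sqrt_five_ne_intCast (5 * d ^ 2 + c ^ 2) ?_
    push_cast
    linear_combination √5 * him + (1 / 5 * (√5 * √5 * d ^ 2 + c ^ 2) + d ^ 2) * h5

theorem cls_rho51_ne_rho52 : cls rho51 ≠ cls rho52 := by
  intro h
  obtain ⟨γ, hγ⟩ := cls_eq_iff.mp h.symm
  have h5 : √5 ^ 2 = 5 := Real.sq_sqrt (by norm_num)
  have h5p : 0 < √5 := by positivity
  have hN : ∀ N : ℤ, 2 * √5 ≠ N := by
    intro N hN
    have h1 : (N : ℝ) ^ 2 = 20 := by rw [← hN, mul_pow, h5]; norm_num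
    have h2 : N ^ 2 = 20 := by exact_mod_cast h1
    have h3 : N < 5 := by nlinarith
    have h4 : -5 < N := by nlinarith
    interval_cases N <;> omega
  have him := im_eq_im_smul_mul γ.1 rho51
  rw [show γ.1 • rho51 = rho52 from hγ, show rho51.im = 1 / (2 * √5) from rfl,
    show rho51.re = -1 / 2 from rfl, show rho52.im = 1 / 5 from rfl, one_div, mul_inv,
    mul_comm _ (√5)⁻¹] at him
  obtain ⟨s, hs⟩ : ∃ s, (√5)⁻¹ = s := ⟨_, rfl⟩
  have hs5 : √5 = 5 * s := by rw [← hs]; field_simp; linarith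
  have hs2 : 5 * s ^ 2 = 1 := by rw [← hs, inv_pow, h5]; norm_num
  rw [hs] at him
  obtain ⟨a, b, c, d, ⟨hd, hγ⟩ | ⟨hd, hγ⟩⟩ := mem_Gamma0Star_five.mp γ.2 <;> rw [hγ] at him
  · replace him : s * 2⁻¹ = 1 / 5 * ((5 * c * (-1 / 2) + d) ^ 2 + (5 * c * (s * 2⁻¹)) ^ 2) := him
    refine hN ((2 * d - 5 * c) ^ 2 + 5 * c ^ 2) ?_
    rw [hs5]
    push_cast
    linear_combination 20 * him + 5 * c ^ 2 * hs2
  · replace him : s * 2⁻¹ = 1 / 5 *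
      ((√5 * c * (-1 / 2) + √5 * d) ^ 2 + (√5 * c * (s * 2⁻¹)) ^ 2) := him
    rw [hs5] at him
    refine hN (5 * (2 * d - c) ^ 2 + c ^ 2) ?_
    rw [hs5]
    push_cast
    linear_combination 20 * him + (5 * (2 * d - c) ^ 2 + c ^ 2 * (5 * s ^ 2 + 1)) * hs2

/-! ### Operations on modular functions and the coordinate q at the cusp. -/

theorem cuspFunction_apply_of_ne_zero (f : ℍ → ℂ) {q : ℂ} (hq : q ≠ 0) :
    cuspFunction 1 f q = f (ofComplex (invQParam 1 q)) :=
  Function.Periodic.cuspFunction_eq_of_nonzero 1 _ hq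

theorem eventually_nhdsNE_ofComplex {P : ℍ → Prop} (h : ∀ᶠ z in codiscrete ℍ, P z) (z : ℍ) :
    ∀ᶠ w in 𝓝[≠] (z : ℂ), P (ofComplex w) := by
  have h1 : ∀ᶠ y in 𝓝[≠] z, P y := by
    have := (mem_codiscrete.mp h) z
    rwa [Filter.disjoint_principal_right, compl_compl] at this
  rw [eventually_nhdsWithin_iff] at h1 ⊢
  rw [← UpperHalfPlane.isOpenEmbedding_coe.map_nhds_eq, Filter.eventually_map]
  filter_upwards [h1] with y hy hne
  rw [UpperHalfPlane.ofComplex_apply]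
  exact hy fun h ↦ hne (congrArg UpperHalfPlane.coe (Set.mem_singleton_iff.mp h))

namespace ModularFunction

section Operations

variable {p : ℕ} [Fact p.Prime] {k : ℤ}

/-- A weight `0` modular function minus a constant. -/
def subConst (f : ModularFunction p 0) (c : ℂ) : ModularFunction p 0 where
  toFun z := f.toFun z - c
  meromorphic z := (f.meromorphic z).fun_sub (MeromorphicAt.const c _)
  transform γ hγ := by
    filter_upwards [f.transform γ hγ] with z hz
    rw [hz]
    simp
  meromorphic_infty := by
    refine (f.meromorphic_infty.fun_sub (MeromorphicAt.const c _)).congr ?_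
    filter_upwards [self_mem_nhdsWithin] with q hq
    rw [cuspFunction_apply_of_ne_zero _ hq, cuspFunction_apply_of_ne_zero _ hq]

theorem order_subConst (f : ModularFunction p 0) (c : ℂ) (z : ℍ) : (f.subConst c).order z =
    meromorphicOrderAt (fun w ↦ (f.toFun ∘ ofComplex) w - c) z := rfl

theorem orderInfty_subConst (f : ModularFunction p 0) (c : ℂ) : (f.subConst c).orderInfty =
    meromorphicOrderAt (fun q ↦ cuspFunction 1 f.toFun q - c) 0 := by
  refine meromorphicOrderAt_congr ?_
  filter_upwards [self_mem_nhdsWithin] with q hq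
  rw [cuspFunction_apply_of_ne_zero _ hq, cuspFunction_apply_of_ne_zero _ hq]
  rfl

/-- The inverse of a modular function. -/
def inv (f : ModularFunction p k) : ModularFunction p (-k) where
  toFun z := (f.toFun z)⁻¹
  meromorphic z := (f.meromorphic z).fun_inv
  transform γ hγ := by
    filter_upwards [f.transform γ hγ] with z hz
    rw [hz, mul_inv, zpow_neg]
  meromorphic_infty := by
    refine f.meromorphic_infty.fun_inv.congr ?_
    filter_upwards [self_mem_nhdsWithin] with q hq
    rw [cuspFunction_apply_of_ne_zero _ hq, cuspFunction_apply_of_ne_zero _ hq]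

theorem order_inv (f : ModularFunction p k) (z : ℍ) : f.inv.order z = -f.order z :=
  meromorphicOrderAt_inv (f := f.toFun ∘ ofComplex)

theorem orderInfty_inv (f : ModularFunction p k) : f.inv.orderInfty = -f.orderInfty := by
  unfold orderInfty
  rw [← meromorphicOrderAt_inv]
  refine meromorphicOrderAt_congr ?_
  filter_upwards [self_mem_nhdsWithin] with q hq
  rw [Pi.inv_apply, cuspFunction_apply_of_ne_zero _ hq, cuspFunction_apply_of_ne_zero _ hq]
  rfl

end Operations

variable {k : ℤ} (f : ModularFunction 5 k)

theorem eventually_add_int_eq (n : ℤ) (z : ℍ) :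
    ∀ᶠ w in 𝓝[≠] (z : ℂ), f.toFun (ofComplex (w + n)) = f.toFun (ofComplex w) := by
  have h := eventually_nhdsNE_ofComplex (f.transform _ (translation n).2) z
  have him : ∀ᶠ w in 𝓝[≠] (z : ℂ), 0 < w.im :=
    nhdsWithin_le_nhds (UpperHalfPlane.isOpen_upperHalfPlaneSet.mem_nhds z.im_pos)
  filter_upwards [h, him] with w hw hwim
  have h1 : ofComplex (w + n) = translation n • ofComplex w := by
    rw [← UpperHalfPlane.coe_inj, coe_translation_smul, UpperHalfPlane.ofComplex_apply_of_im_pos hwim,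
      UpperHalfPlane.ofComplex_apply_of_im_pos (by simpa using hwim)]
  have h10 : (translation n).1.1 1 0 = 0 := by simp [translation, ofGamma0]
  have h11 : (translation n).1.1 1 1 = 1 := by simp [translation, ofGamma0]
  rw [h1]
  refine Eq.trans hw ?_
  rw [h10, h11]
  simp

theorem abs_re_invQParam_le (q : ℂ) : |(invQParam 1 q).re| ≤ 1 / 2 := by
  have h : (invQParam 1 q).re = q.arg / (2 * Real.pi) := by
    rw [invQParam, Complex.ofReal_one, div_mul_eq_mul_div, one_mul,
      show Complex.log q / (2 * Real.pi * Complex.I) =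
        Complex.log q / Complex.I / ((2 * Real.pi : ℝ) : ℂ) by push_cast; field_simp,
      Complex.div_ofReal_re, Complex.div_I]
    simp [Complex.log_im]
  rw [h, abs_div, abs_of_pos Real.two_pi_pos, div_le_div_iff₀ Real.two_pi_pos two_pos]
  linarith [Complex.abs_arg_le_pi q]

/-- `cuspFunction` evaluates `f` at the translate with |Re| ≤ 1/2, while periodicity holds only off
a discrete set that depends on the translation. Near z finitely many translations occur, so their
exceptional sets can be avoided together. -/
theorem eventually_cuspFunction_qParam_eq (z : ℍ) :
    ∀ᶠ w in 𝓝[≠] (z : ℂ), cuspFunction 1 f.toFun (qParam 1 w) = (f.toFun ∘ ofComplex) w := by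
  -- The 3/2 is the radius 1 of the ball around z plus the bound 1/2 on the real part.
  set B : ℤ := ⌈|z.re| + 3 / 2⌉ with hB
  have h1 : ∀ᶠ w in 𝓝[≠] (z : ℂ), ∀ n ∈ Set.Icc (-B) B,
      f.toFun (ofComplex (w + n)) = f.toFun (ofComplex w) :=
    (Set.finite_Icc _ _).eventually_all.mpr fun n _ ↦ f.eventually_add_int_eq n z
  have h2 : ∀ᶠ w in 𝓝[≠] (z : ℂ), w ∈ Metric.ball (z : ℂ) 1 :=
    nhdsWithin_le_nhds (Metric.ball_mem_nhds _ one_pos)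
  filter_upwards [h1, h2] with w hw hwz
  obtain ⟨m, hm⟩ := qParam_left_inv_mod_period one_ne_zero w
  rw [cuspFunction_apply_of_ne_zero _ (Function.Periodic.qParam_ne_zero w), hm]
  rw [Complex.ofReal_one, mul_one]
  refine hw m ?_
  have h3 := abs_re_invQParam_le (qParam 1 w)
  rw [hm] at h3
  have h4 : |(m : ℝ)| ≤ B := by
    refine le_trans ?_ (Int.le_ceil _)
    have h5 : |w.re - z.re| < 1 := by
      refine lt_of_le_of_lt ?_ (mem_ball_iff_norm.mp hwz)
      simpa using Complex.abs_re_le_norm (w - z)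
    have h6 : |w.re + m| ≤ 1 / 2 := by simpa using h3
    rw [abs_le] at h6 ⊢
    rw [abs_lt] at h5
    have h7 := abs_le.mp (le_refl |z.re|)
    constructor <;> linarith
  rw [abs_le] at h4
  exact ⟨by exact_mod_cast h4.1, by exact_mod_cast h4.2⟩

/-- Orders are preserved because q = exp(2πiz) has nowhere vanishing derivative. -/
theorem zeroOrd_eq_zeroOrd_cuspFunction (c : ℂ) (z : ℍ) :
    zeroOrd (f.toFun ∘ ofComplex) c z = zeroOrd (cuspFunction 1 f.toFun) c (qParam 1 z) := by
  have hd : deriv (qParam 1) z ≠ 0 := by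
    have : HasDerivAt (qParam 1) (Complex.exp (2 * Real.pi * Complex.I * z / (1 : ℝ)) *
        (2 * Real.pi * Complex.I * 1 / (1 : ℝ))) z :=
      (((hasDerivAt_id (z : ℂ)).const_mul _).div_const _).cexp
    rw [this.deriv]
    simp [Complex.exp_ne_zero, Real.pi_ne_zero]
  have han : AnalyticAt ℂ (qParam 1) z :=
    (Function.Periodic.differentiable_qParam (h := 1)).analyticAt _
  rw [← zeroOrd_congr (f.eventually_cuspFunction_qParam_eq z)]
  unfold zeroOrd
  rw [← meromorphicOrderAt_comp_of_deriv_ne_zero han hd]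
  rfl

theorem zeroOrd_smul (f : ModularFunction 5 0) (c : ℂ) (γ : Gamma0Star 5) (z : ℍ) :
    zeroOrd (f.toFun ∘ ofComplex) c (γ • z : ℍ) = zeroOrd (f.toFun ∘ ofComplex) c z := by
  have := (f.subConst c).order_smul γ.2 z
  rw [order_subConst, order_subConst] at this
  unfold zeroOrd
  rw [← this]
  rfl

end ModularFunction

/-! ### The quotient and its one-point compactification. -/

/-- The quotient `Γ₀*(5) \ ℍ`. -/
abbrev Quo : Type := MulAction.orbitRel.Quotient (Gamma0Star 5) ℍ

theorem isOpenQuotientMap_cls : IsOpenQuotientMap cls :=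
  MulAction.isOpenQuotientMap_quotientMk

/-- Needed for `OnePoint Quo` to be Hausdorff. -/
instance : LocallyCompactSpace Quo := isOpenQuotientMap_cls.locallyCompactSpace

theorem im_le_of_cls_eq {z w : ℍ} (h : cls z = cls w) : z.im ≤ max w.im (1 / (5 * w.im)) := by
  obtain ⟨γ, rfl⟩ := cls_eq_iff.mp h
  rcases eq_translation_or_im_le γ w with ⟨n, hn⟩ | hle
  · rw [hn w]
    exact le_max_of_le_left ((translation_smul_eq_iff n w _).mp rfl).2.ge
  · refine le_max_of_le_right ?_
    have := w.im_pos
    rw [le_div_iff₀ (by positivity)]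
    linarith

theorem exists_translation_of_cls_eq {z w : ℍ} (h : cls z = cls w) (hz : 1 ≤ z.im)
    (hw : 1 ≤ w.im) : ∃ n : ℤ, (z : ℂ) = w + n := by
  obtain ⟨γ, rfl⟩ := cls_eq_iff.mp h
  rcases eq_translation_or_im_le γ w with ⟨n, hn⟩ | hle
  · exact ⟨n, by rw [hn w, coe_translation_smul]⟩
  · nlinarith

/-- The elliptic points have heights in [1/5, 1], and the orbit of such a point never rises above
height 1. -/
theorem card_stabilizer_eq_two_of_one_lt_im {z : ℍ} (hz : 1 < z.im) :
    Nat.card (MulAction.stabilizer (Gamma0Star 5) z) = 2 := by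
  have h5 : √5 ^ 2 = 5 := Real.sq_sqrt (by norm_num)
  have h5p : 0 < √5 := by positivity
  have h2 : (2 : ℝ) ≤ √5 := Real.le_sqrt_of_sq_le (by norm_num)
  have h3 : √5 ≤ (5 / 2 : ℝ) := Real.sqrt_le_iff.mpr (by norm_num)
  have key : ∀ w : ℍ, w.im ≤ 1 → 1 / 5 ≤ w.im → cls z ≠ cls w := by
    intro w h1 h2 h
    have h3 := im_le_of_cls_eq h
    have h4 : max w.im (1 / (5 * w.im)) ≤ 1 := by
      refine max_le h1 ?_
      have := w.im_pos
      rw [div_le_one (by positivity)]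
      linarith
    linarith
  refine card_stabilizer_eq_two_of_cls ?_
  rintro (h | h | h)
  · refine key iDivSqrtFive ?_ ?_ h
    · change 1 / √5 ≤ 1
      rw [div_le_one h5p]
      linarith
    · change 1 / 5 ≤ 1 / √5
      exact one_div_le_one_div_of_le h5p (by linarith)
  · refine key rho51 ?_ ?_ h
    · change 1 / (2 * √5) ≤ 1
      rw [div_le_one (by positivity)]
      linarith
    · change 1 / 5 ≤ 1 / (2 * √5)
      exact one_div_le_one_div_of_le (by positivity) (by linarith)
  · refine key rho52 ?_ ?_ h
    · change (1 / 5 : ℝ) ≤ 1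
      norm_num
    · change (1 / 5 : ℝ) ≤ 1 / 5
      norm_num

theorem qParam_add_intCast (w : ℂ) (n : ℤ) : qParam 1 (w + n) = qParam 1 w := by
  unfold qParam
  rw [Complex.exp_eq_exp_iff_exists_int]
  exact ⟨n, by push_cast; ring⟩

/-- The image in `Γ₀*(5) \ ℍ` of the points of height at most `Y` is relatively compact. -/
theorem exists_isCompact_compl_subset (Y : ℝ) : ∃ K : Set Quo, IsCompact K ∧
    (cls '' {z : ℍ | Y < z.im})ᶜ ⊆ K := by
  -- The bound 1/10 is a convenient number below √3/10.
  let K : Set ℍ := {z | z.re ∈ Set.Icc (-(1 / 2)) (1 / 2) ∧ z.im ∈ Set.Icc (1 / 10) Y}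
  have hK : IsCompact K := by
    rw [UpperHalfPlane.isOpenEmbedding_coe.isInducing.isCompact_iff]
    convert (isCompact_Icc (a := (-(1 / 2) : ℝ)) (b := 1 / 2)).reProdIm
      (isCompact_Icc (a := (1 / 10 : ℝ)) (b := Y)) using 1
    ext w
    rw [Complex.mem_reProdIm]
    constructor
    · rintro ⟨z, hz, rfl⟩
      exact hz
    · intro hw
      exact ⟨⟨w, lt_of_lt_of_le (by norm_num) hw.2.1⟩, hw, rfl⟩
  refine ⟨cls '' K, hK.image isOpenQuotientMap_cls.continuous, fun x hx ↦ ?_⟩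
  obtain ⟨z, rfl⟩ := isOpenQuotientMap_cls.surjective x
  obtain ⟨γ, h1, h2⟩ := exists_abs_re_le z
  refine ⟨γ • z, ⟨abs_le.mp h1, ?_, ?_⟩, cls_smul γ z⟩
  · have := (γ • z).im_pos
    nlinarith
  · by_contra! hlt
    exact hx ⟨γ • z, hlt, cls_smul γ z⟩

theorem cuspNhd_mem_nhds (Y : ℝ) :
    insert OnePoint.infty ((↑) '' (cls '' {z : ℍ | Y < z.im})) ∈ 𝓝 (OnePoint.infty : OnePoint Quo) := by
  obtain ⟨K, hK, hsub⟩ := exists_isCompact_compl_subset Y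
  rw [Set.insert_eq, Set.union_comm]
  have hopen : IsOpen (cls '' {z : ℍ | Y < z.im}) :=
    isOpenQuotientMap_cls.isOpenMap _ (isOpen_lt continuous_const UpperHalfPlane.continuous_im)
  refine OnePoint.hasBasis_nhds_infty.mem_iff.mpr ⟨(cls '' {z : ℍ | Y < z.im})ᶜ,
    ⟨hopen.isClosed_compl, hK.of_isClosed_subset hopen.isClosed_compl hsub⟩, ?_⟩
  rw [compl_compl]

/-- A compact subset of the quotient is covered by finitely many images of strips Im p / 2 < Im w <
2 Im p, and the orbits meeting such a strip have bounded height. -/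
theorem exists_cuspNhd_subset {V : Set (OnePoint Quo)} (hV : V ∈ 𝓝 OnePoint.infty) :
    ∃ Y : ℝ, insert OnePoint.infty ((↑) '' (cls '' {z : ℍ | Y < z.im})) ⊆ V := by
  obtain ⟨K, ⟨-, hK⟩, hKV⟩ := OnePoint.hasBasis_nhds_infty.mem_iff.mp hV
  let N : ℍ → Set ℍ := fun p ↦ {w | p.im / 2 < w.im ∧ w.im < 2 * p.im}
  have hN : ∀ p, cls '' N p ∈ 𝓝 (cls p) := by
    intro p
    refine isOpenQuotientMap_cls.isOpenMap.image_mem_nhds (IsOpen.mem_nhds ?_ ?_)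
    · exact (isOpen_lt continuous_const UpperHalfPlane.continuous_im).inter
        (isOpen_lt UpperHalfPlane.continuous_im continuous_const)
    · have := p.im_pos
      exact ⟨by linarith, by linarith⟩
  obtain ⟨t, -, ht⟩ := hK.elim_nhds_subcover (fun x ↦ cls '' N x.out) fun x _ ↦ by
    have := hN x.out
    rwa [show cls x.out = x from Quotient.out_eq x] at this
  obtain ⟨Y, hY⟩ := (t.image fun x : Quo ↦ max (2 * x.out.im) (1 / (5 * (x.out.im / 2)))).exists_le
  refine ⟨Y, ?_⟩
  rintro _ (rfl | ⟨_, ⟨z, hz, rfl⟩, rfl⟩)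
  · exact hKV (Or.inr rfl)
  · refine hKV (Or.inl ⟨cls z, fun hzK ↦ ?_, rfl⟩)
    obtain ⟨x, hx, w, hw, hwz⟩ := Set.mem_iUnion₂.mp (ht hzK)
    have h1 := im_le_of_cls_eq hwz.symm
    have h2 := hY _ (Finset.mem_image_of_mem _ hx)
    have h3 := x.out.im_pos
    have h4 : max w.im (1 / (5 * w.im)) ≤
        max (2 * x.out.im) (1 / (5 * (x.out.im / 2))) := by
      refine max_le_max hw.2.le (one_div_le_one_div_of_le (by positivity) ?_)
      linarith [hw.1]
    exact absurd (Set.mem_ofPred_eq.mp hz) (not_lt.mpr (h1.trans (h4.trans h2)))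

/-! ### Counting the solutions of f = c on the compactified quotient. -/

namespace ModularFunction

variable (f : ModularFunction 5 0)

/-- The order of vanishing of `f - c` on `Γ₀*(5) \ ℍ`, with the weight of the orbit. -/
def weightedOrd (c : ℂ) : Quo → ℚ :=
  Quotient.lift (fun z ↦ (zeroOrd (f.toFun ∘ ofComplex) c z : ℚ) /
    Nat.card (MulAction.stabilizer (Gamma0Star 5) z)) (by
      rintro _ z ⟨γ, rfl⟩
      dsimp only
      rw [f.zeroOrd_smul, card_stabilizer_eq_of_cls_eq (cls_smul γ z)])

theorem weightedOrd_cls (c : ℂ) (z : ℍ) : f.weightedOrd c (cls z) =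
    (zeroOrd (f.toFun ∘ ofComplex) c z : ℚ) /
      Nat.card (MulAction.stabilizer (Gamma0Star 5) z) := rfl

/-- The order of vanishing of `f - c` on the compactified quotient. -/
def totalOrd (c : ℂ) (x : OnePoint Quo) : ℚ :=
  -- The cusp gets the weight 1/2 of the points near it, whose stabilizers are {±1}; otherwise the
  -- local count would jump there.
  x.elim ((zeroOrd (cuspFunction 1 f.toFun) c 0 : ℚ) / 2) (f.weightedOrd c)

theorem totalOrd_infty (c : ℂ) : f.totalOrd c OnePoint.infty =
    (zeroOrd (cuspFunction 1 f.toFun) c 0 : ℚ) / 2 := rfl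

theorem totalOrd_coe (c : ℂ) (x : Quo) : f.totalOrd c x = f.weightedOrd c x := rfl

theorem weightedOrd_nonneg (c : ℂ) (x : Quo) : 0 ≤ f.weightedOrd c x := by
  obtain ⟨z, rfl⟩ := isOpenQuotientMap_cls.surjective x
  rw [weightedOrd_cls]
  positivity

theorem totalOrd_nonneg (c : ℂ) (x : OnePoint Quo) : 0 ≤ f.totalOrd c x := by
  induction x using OnePoint.rec with
  | infty => rw [totalOrd_infty]; positivity
  | coe x => exact f.weightedOrd_nonneg c x

/-- High points are equivalent only under translations, so a small q-disc is in bijection with a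
neighbourhood of the cusp and Hurwitz's theorem at q = 0 carries over. -/
theorem exists_nhds_infty_finsum_totalOrd {c₀ : ℂ} (h : (f.subConst c₀).orderInfty ≠ ⊤)
    {V : Set (OnePoint Quo)} (hV : V ∈ 𝓝 OnePoint.infty) :
    ∃ U ∈ 𝓝 (OnePoint.infty : OnePoint Quo), U ⊆ V ∧ ∀ᶠ c in 𝓝 c₀,
      (U ∩ Function.support (f.totalOrd c)).Finite ∧
        ∑ᶠ y ∈ U, f.totalOrd c y = f.totalOrd c₀ OnePoint.infty := by
  rw [orderInfty_subConst] at h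
  obtain ⟨U₀, hU₀, hloc⟩ := exists_nhds_finsum_zeroOrd f.meromorphic_infty h
  obtain ⟨Y₁, hY₁⟩ := exists_cuspNhd_subset hV
  obtain ⟨ε, hε, hball⟩ := Metric.mem_nhds_iff.mp hU₀
  -- The three conditions put the neighbourhood inside `V`, reduce equivalence to translations, and
  -- put the q-disc inside the Hurwitz neighbourhood.
  obtain ⟨Y, hYY₁, hY1, hYε⟩ : ∃ Y : ℝ, Y₁ ≤ Y ∧ 1 ≤ Y ∧ Real.exp (-2 * Real.pi * Y / 1) ≤ ε := by
    have ht : Tendsto (fun Y : ℝ ↦ Real.exp (-2 * Real.pi * Y / 1)) atTop (𝓝 0) := by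
      refine Real.tendsto_exp_atBot.comp ?_
      simp only [div_one]
      exact tendsto_id.const_mul_atTop_of_neg (by linarith [Real.pi_pos])
    obtain ⟨Y, h1, h2, h3⟩ := ((eventually_ge_atTop Y₁).and ((eventually_ge_atTop 1).and
      (ht.eventually (ge_mem_nhds hε)))).exists
    exact ⟨Y, h1, h2, h3⟩
  refine ⟨_, cuspNhd_mem_nhds Y, (Set.insert_subset_insert (Set.image_mono (Set.image_mono
    fun z hz ↦ hYY₁.trans_lt hz))).trans hY₁, ?_⟩
  set D : Set ℂ := Metric.ball 0 (Real.exp (-2 * Real.pi * Y / 1)) with hD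
  filter_upwards [hloc D (Metric.ball_mem_nhds 0 (Real.exp_pos _))
    ((Metric.ball_subset_ball hYε).trans hball)] with c hc
  have hmemD : ∀ z : ℍ, qParam 1 z ∈ D ↔ Y < z.im := by
    intro z
    rw [hD, mem_ball_zero_iff]
    exact Function.Periodic.norm_qParam_lt_iff one_pos Y z
  have hlift : ∀ q ∈ D, q ≠ 0 → qParam 1 (ofComplex (invQParam 1 q)) = q := by
    intro q hq hq0
    have hq1 : ‖q‖ < 1 := by
      refine (mem_ball_zero_iff.mp hq).trans_le (Real.exp_le_one_iff.mpr ?_)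
      have := Real.pi_pos
      simp only [div_one]
      nlinarith
    rw [UpperHalfPlane.ofComplex_apply_of_im_pos
      (Function.Periodic.im_invQParam_pos_of_norm_lt_one one_pos hq1 hq0)]
    exact qParam_right_inv one_ne_zero hq0
  have hcls : ∀ z w : ℍ, Y < z.im → Y < w.im → (cls z = cls w ↔ qParam 1 z = qParam 1 w) := by
    intro z w hz hw
    constructor
    · intro hzw
      obtain ⟨n, hn⟩ := exists_translation_of_cls_eq hzw (by linarith) (by linarith)
      rw [hn]
      exact qParam_add_intCast w n
    · intro hq
      obtain ⟨m, hm⟩ := qParam_left_inv_mod_period one_ne_zero (z : ℂ)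
      obtain ⟨n, hn⟩ := qParam_left_inv_mod_period one_ne_zero (w : ℂ)
      rw [hq, hn] at hm
      have : translation (m - n) • z = w := by
        rw [← UpperHalfPlane.coe_inj, coe_translation_smul]
        push_cast at hm ⊢
        linear_combination -hm
      rw [← this, cls_smul]
  have hval : ∀ z : ℍ, Y < z.im → f.totalOrd c (cls z) =
      (zeroOrd (cuspFunction 1 f.toFun) c (qParam 1 z) : ℚ) / 2 := by
    intro z hz
    rw [totalOrd_coe, weightedOrd_cls, card_stabilizer_eq_two_of_one_lt_im (by linarith),
      zeroOrd_eq_zeroOrd_cuspFunction]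
    norm_num
  let Ψ : ℂ → OnePoint Quo := fun q ↦
    if q = 0 then OnePoint.infty else cls (ofComplex (invQParam 1 q))
  have hΨ0 : Ψ 0 = OnePoint.infty := if_pos rfl
  have hΨ : ∀ q, q ≠ 0 → Ψ q = cls (ofComplex (invQParam 1 q)) := fun q hq ↦ if_neg hq
  have hΨim : ∀ q ∈ D, q ≠ 0 → Y < (ofComplex (invQParam 1 q)).im := fun q hq hq0 ↦
    (hmemD _).mp (by rwa [hlift q hq hq0])
  have hbij : Set.BijOn Ψ D
      (insert OnePoint.infty ((↑) '' (cls '' {z : ℍ | Y < z.im}))) := by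
    refine ⟨fun q hq ↦ ?_, fun q hq q' hq' heq ↦ ?_, ?_⟩
    · by_cases hq0 : q = 0
      · exact Or.inl (hq0 ▸ hΨ0)
      · rw [hΨ q hq0]
        exact Or.inr ⟨_, ⟨_, hΨim q hq hq0, rfl⟩, rfl⟩
    · by_cases hq0 : q = 0 <;> by_cases hq0' : q' = 0
      · rw [hq0, hq0']
      · rw [hq0, hΨ0, hΨ q' hq0'] at heq
        exact absurd heq.symm (OnePoint.coe_ne_infty _)
      · rw [hq0', hΨ0, hΨ q hq0] at heq
        exact absurd heq (OnePoint.coe_ne_infty _)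
      · rw [hΨ q hq0, hΨ q' hq0', OnePoint.coe_eq_coe, hcls _ _ (hΨim q hq hq0)
          (hΨim q' hq' hq0'), hlift q hq hq0, hlift q' hq' hq0'] at heq
        exact heq
    · rintro _ (rfl | ⟨_, ⟨z, hz, rfl⟩, rfl⟩)
      · exact ⟨0, Metric.mem_ball_self (Real.exp_pos _), hΨ0⟩
      · have hzD := (hmemD z).mpr hz
        have hz0 := Function.Periodic.qParam_ne_zero (h := 1) (z : ℂ)
        refine ⟨qParam 1 z, hzD, ?_⟩
        rw [hΨ _ hz0, OnePoint.coe_eq_coe, hcls _ _ (hΨim _ hzD hz0) hz, hlift _ hzD hz0]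
  have hord : ∀ q ∈ D, (zeroOrd (cuspFunction 1 f.toFun) c q : ℚ) / 2 = f.totalOrd c (Ψ q) := by
    intro q hq
    by_cases hq0 : q = 0
    · rw [hq0, hΨ0, totalOrd_infty]
    · rw [hΨ q hq0, hval _ (hΨim q hq hq0), hlift q hq hq0]
  constructor
  · refine (hc.1.image Ψ).subset ?_
    rintro x ⟨hx, hx0⟩
    obtain ⟨q, hq, rfl⟩ := hbij.surjOn hx
    refine ⟨q, ⟨hq, fun h0 ↦ hx0 ?_⟩, rfl⟩
    rw [← hord q hq, h0]
    simp
  · rw [← finsum_mem_eq_of_bijOn Ψ hbij hord, totalOrd_infty, ← hc.2]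
    exact (((AddMonoidHom.mulRight (2⁻¹ : ℚ)).comp (Nat.castAddMonoidHom ℚ)).map_finsum_mem'
      hc.1).symm

theorem exists_nhds_coe_finsum_totalOrd {c₀ : ℂ} {p : ℍ} (h : (f.subConst c₀).order p ≠ ⊤)
    {V : Set (OnePoint Quo)} (hV : V ∈ 𝓝 (cls p : OnePoint Quo)) :
    ∃ U ∈ 𝓝 (cls p : OnePoint Quo), U ⊆ V ∧ ∀ᶠ c in 𝓝 c₀,
      (U ∩ Function.support (f.totalOrd c)).Finite ∧
        ∑ᶠ y ∈ U, f.totalOrd c y = f.totalOrd c₀ (cls p) := by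
  rw [order_subConst] at h
  obtain ⟨U₀, hU₀, hloc⟩ := exists_nhds_finsum_zeroOrd (f.meromorphic p) h
  obtain ⟨A, hA, hAp⟩ :=
    ProperlyDiscontinuousSMul.exists_nhds_image_smul_eq_self (Gamma0Star 5) p
  have hB : (fun z : ℍ ↦ (z : ℂ)) ⁻¹' U₀ ∈ 𝓝 p :=
    UpperHalfPlane.continuous_coe.continuousAt hU₀
  have hC : (fun z : ℍ ↦ (cls z : OnePoint Quo)) ⁻¹' V ∈ 𝓝 p :=
    (OnePoint.continuous_coe.comp isOpenQuotientMap_cls.continuous).continuousAt hV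
  have hstab : Finite (MulAction.stabilizer (Gamma0Star 5) p) :=
    ProperlyDiscontinuousSMul.finite_stabilizer p
  set U₁ : Set ℍ := A ∩ ((fun z : ℍ ↦ (z : ℂ)) ⁻¹' U₀ ∩
    (fun z : ℍ ↦ (cls z : OnePoint Quo)) ⁻¹' V) with hU₁
  have hU₁p : U₁ ∈ 𝓝 p := inter_mem hA (inter_mem hB hC)
  -- Intersecting over the finite stabilizer makes `U` stable under it; being inside `A`, `U` meets
  -- none of its translates by other elements.
  let U : Set ℍ := ⋂ γ : MulAction.stabilizer (Gamma0Star 5) p, (fun z ↦ γ.1 • z) ⁻¹' U₁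
  have hUp : U ∈ 𝓝 p := by
    refine iInter_mem.mpr fun γ ↦ (continuous_const_smul γ.1).continuousAt ?_
    rwa [show γ.1 • p = p from γ.2]
  have hUU₁ : U ⊆ U₁ := fun z hz ↦ by
    have := Set.mem_iInter.mp hz 1
    rwa [Set.mem_preimage, OneMemClass.coe_one, one_smul] at this
  have hinv : ∀ γ : Gamma0Star 5, ∀ q ∈ U, γ • q ∈ U ↔ γ • p = p := by
    intro γ q hq
    constructor
    · intro hγq
      exact hAp γ ⟨γ • q, ⟨q, (hUU₁ hq).1, rfl⟩, (hUU₁ hγq).1⟩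
    · intro hγ
      refine Set.mem_iInter.mpr fun δ ↦ ?_
      have := Set.mem_iInter.mp hq (δ * ⟨γ, hγ⟩)
      rwa [Set.mem_preimage, Subgroup.coe_mul, mul_smul] at this
  have hinj : Set.InjOn (fun z : ℍ ↦ (z : ℂ)) U :=
    UpperHalfPlane.isOpenEmbedding_coe.injective.injOn
  refine ⟨(↑) '' (cls '' U), OnePoint.isOpenEmbedding_coe.image_mem_nhds.mpr
    (isOpenQuotientMap_cls.isOpenMap.image_mem_nhds hUp), ?_, ?_⟩
  · rintro _ ⟨_, ⟨z, hz, rfl⟩, rfl⟩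
    exact (hUU₁ hz).2.2
  filter_upwards [hloc ((fun z : ℍ ↦ (z : ℂ)) '' U)
    (UpperHalfPlane.isOpenEmbedding_coe.image_mem_nhds.mpr hUp)
    (by rintro _ ⟨z, hz, rfl⟩; exact (hUU₁ hz).2.1)] with c hc
  obtain ⟨hfin, hsum⟩ := hc
  rw [finsum_mem_image hinj] at hsum
  have hfin' : (U ∩ Function.support
      fun z : ℍ ↦ zeroOrd (f.toFun ∘ ofComplex) c z).Finite := by
    refine Set.Finite.of_finite_image (hfin.subset ?_)
      (hinj.mono Set.inter_subset_left)
    rintro _ ⟨z, ⟨hz, hz0⟩, rfl⟩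
    exact ⟨⟨z, hz, rfl⟩, hz0⟩
  obtain ⟨h1, h2⟩ := finsum_orbit_eq_finsum hinv (f.weightedOrd_cls c) hfin'
  constructor
  · refine (h1.image ((↑) : Quo → OnePoint Quo)).subset ?_
    rintro _ ⟨⟨x, hx, rfl⟩, hx0⟩
    exact ⟨x, ⟨hx, hx0⟩, rfl⟩
  · rw [finsum_mem_image OnePoint.coe_injective.injOn, totalOrd_coe, weightedOrd_cls, ← hsum]
    exact h2

/-- A nonconstant weight `0` modular function takes every value the same number of times. -/
theorem finsum_totalOrd_eq (h : ∀ c z, (f.subConst c).order z ≠ ⊤)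
    (h' : ∀ c, (f.subConst c).orderInfty ≠ ⊤) :
    (∀ c, (Function.support (f.totalOrd c)).Finite) ∧
      ∀ c c', ∑ᶠ x, f.totalOrd c x = ∑ᶠ x, f.totalOrd c' x := by
  refine finsum_eq_finsum_of_local f.totalOrd_nonneg fun c₀ x V hV ↦ ?_
  induction x using OnePoint.rec with
  | infty => exact f.exists_nhds_infty_finsum_totalOrd (h' c₀) hV
  | coe x =>
    obtain ⟨z, rfl⟩ := isOpenQuotientMap_cls.surjective x
    exact f.exists_nhds_coe_finsum_totalOrd (h c₀ z) hV

end ModularFunction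

/-! ### Zeros against poles: the degree of a weight 0 function. -/

theorem zeroOrd_zero (F : ℂ → ℂ) (z : ℂ) :
    zeroOrd F 0 z = (meromorphicOrderAt F z).untop₀.toNat := by
  simp [zeroOrd]

/-- As F⁻¹ − 1 = −(F − 1)F⁻¹, the orders agree where F has order 0. At a zero or pole of F neither F
− 1 nor F⁻¹ − 1 has positive order, and both truncate to 0. -/
theorem zeroOrd_inv_one {F : ℂ → ℂ} {z : ℂ} (hF : MeromorphicAt F z)
    (h : meromorphicOrderAt F z ≠ ⊤) : zeroOrd F⁻¹ 1 z = zeroOrd F 1 z := by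
  have hsub : MeromorphicAt (F - fun _ ↦ (1 : ℂ)) z := hF.sub (MeromorphicAt.const 1 z)
  have hord : meromorphicOrderAt (fun w ↦ F⁻¹ w - 1) z =
      meromorphicOrderAt (F - fun _ ↦ (1 : ℂ)) z + -meromorphicOrderAt F z := by
    rw [← meromorphicOrderAt_inv, meromorphicOrderAt_neg (f := F⁻¹), ← meromorphicOrderAt_mul hsub hF.inv.neg]
    refine meromorphicOrderAt_congr ?_
    filter_upwards [(meromorphicOrderAt_ne_top_iff_eventually_ne_zero hF).mp h] with w hw
    simp only [Pi.inv_apply, Pi.mul_apply, Pi.sub_apply, Pi.neg_apply]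
    field_simp
    ring
  unfold zeroOrd
  rw [hord]
  change _ = (meromorphicOrderAt (F - fun _ ↦ (1 : ℂ)) z).untop₀.toNat
  by_cases h0 : meromorphicOrderAt F z = 0
  · rw [h0]
    simp
  have hc : meromorphicOrderAt (-fun _ : ℂ ↦ (1 : ℂ)) z = 0 := by
    rw [← meromorphicOrderAt_neg]
    classical
    rw [meromorphicOrderAt_const, if_neg one_ne_zero]
  have hmin : meromorphicOrderAt (F - fun _ ↦ (1 : ℂ)) z = min (meromorphicOrderAt F z) 0 := by
    rw [sub_eq_add_neg, meromorphicOrderAt_add_of_ne hF (MeromorphicAt.const 1 z).neg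
      (by rwa [hc]), hc]
  rw [hmin]
  obtain ⟨n, hn⟩ := WithTop.ne_top_iff_exists.mp h
  rw [← hn] at h0 ⊢
  have h0' : n ≠ 0 := by exact_mod_cast h0
  have h1 : min (n : WithTop ℤ) 0 = ((min n 0 : ℤ) : WithTop ℤ) := by
    rw [WithTop.coe_min]
    rfl
  rw [h1, ← WithTop.LinearOrderedAddCommGroup.coe_neg, ← WithTop.coe_add, WithTop.untop₀_coe,
    WithTop.untop₀_coe]
  omega

namespace ModularFunction

section

variable {k : ℤ} (f : ModularFunction 5 k)

theorem order_eq_top_of_order_eq_top {z : ℍ} (h : f.order z = ⊤) (w : ℍ) : f.order w = ⊤ := by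
  by_contra hw
  have hm : MeromorphicOn (f.toFun ∘ ofComplex) UpperHalfPlane.upperHalfPlaneSet := by
    intro x hx
    exact f.meromorphic ⟨x, hx⟩
  have hU : IsPreconnected UpperHalfPlane.upperHalfPlaneSet :=
    (convex_halfSpace_im_gt 0).isPreconnected
  exact hm.meromorphicOrderAt_ne_top_of_isPreconnected hU w.im_pos z.im_pos hw h

/-- A property holding on a punctured q-disc holds around a high point of ℍ. Applied to vanishing
and to non-vanishing, and combined with the identity theorem on ℍ, this gives both directions. -/
theorem orderInfty_eq_top_iff (z : ℍ) : f.orderInfty = ⊤ ↔ f.order z = ⊤ := by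
  have key : ∀ P : ℂ → Prop, (∀ᶠ q in 𝓝[≠] (0 : ℂ), P (cuspFunction 1 f.toFun q)) →
      ∃ w : ℍ, ∀ᶠ x in 𝓝[≠] (w : ℂ), P ((f.toFun ∘ ofComplex) x) := by
    intro P hP
    have h1 := (Function.Periodic.qParam_tendsto one_pos).eventually hP
    rw [eventually_comap] at h1
    obtain ⟨Y, hY⟩ := eventually_atTop.mp h1
    let w : ℍ := ⟨⟨0, max Y 0 + 1⟩, by positivity⟩
    refine ⟨w, ?_⟩
    have h2 : ∀ᶠ x in 𝓝[≠] (w : ℂ), Y < x.im := by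
      refine nhdsWithin_le_nhds ((isOpen_lt continuous_const Complex.continuous_im).mem_nhds ?_)
      change Y < max Y 0 + 1
      linarith [le_max_left Y 0]
    filter_upwards [f.eventually_cuspFunction_qParam_eq w, h2] with x hx hxY
    rw [← hx]
    exact hY x.im hxY.le x rfl
  rcases f.meromorphic_infty.eventually_eq_zero_or_eventually_ne_zero with h | h
  · obtain ⟨w, hw⟩ := key (· = 0) h
    have h1 : f.orderInfty = ⊤ := meromorphicOrderAt_eq_top_iff.mpr h
    have h2 : f.order w = ⊤ := meromorphicOrderAt_eq_top_iff.mpr hw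
    simp [h1, f.order_eq_top_of_order_eq_top h2 z]
  · obtain ⟨w, hw⟩ := key (· ≠ 0) h
    have h1 : f.orderInfty ≠ ⊤ :=
      (meromorphicOrderAt_ne_top_iff_eventually_ne_zero f.meromorphic_infty).mpr h
    have h2 : f.order w ≠ ⊤ :=
      (meromorphicOrderAt_ne_top_iff_eventually_ne_zero (f.meromorphic w)).mpr hw
    exact iff_of_false h1 fun h3 ↦ h2 (f.order_eq_top_of_order_eq_top h3 w)

theorem order_ne_top_of_not_isZero (hf : ¬f.IsZero) (z : ℍ) : f.order z ≠ ⊤ := by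
  refine fun h ↦ hf ?_
  rw [IsZero, Filter.Eventually, mem_codiscrete]
  intro w
  rw [Filter.disjoint_principal_right, compl_compl]
  have h1 := meromorphicOrderAt_eq_top_iff.mp (f.order_eq_top_of_order_eq_top h w)
  have h2 : Tendsto (fun y : ℍ ↦ (y : ℂ)) (𝓝[≠] w) (𝓝[≠] (w : ℂ)) :=
    UpperHalfPlane.continuous_coe.continuousAt.continuousWithinAt.tendsto_nhdsWithin fun y hy h0 ↦
      hy (UpperHalfPlane.coe_inj.mp h0)
  filter_upwards [h2.eventually h1] with y hy
  simpa using hy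

end

variable (f : ModularFunction 5 0)

theorem zeroOrd_cuspFunction_inv (c : ℂ) : zeroOrd (cuspFunction 1 f.inv.toFun) c 0 =
    zeroOrd (cuspFunction 1 f.toFun)⁻¹ c 0 := by
  refine zeroOrd_congr ?_ c
  filter_upwards [self_mem_nhdsWithin] with q hq
  rw [Pi.inv_apply, cuspFunction_apply_of_ne_zero _ hq, cuspFunction_apply_of_ne_zero _ hq]
  rfl

theorem totalOrd_inv_one (h : ∀ z, f.order z ≠ ⊤) (x : OnePoint Quo) :
    f.inv.totalOrd 1 x = f.totalOrd 1 x := by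
  induction x using OnePoint.rec with
  | infty =>
    have : f.orderInfty ≠ ⊤ := fun h0 ↦ h UpperHalfPlane.I ((f.orderInfty_eq_top_iff _).mp h0)
    refine congrArg (fun n : ℕ ↦ (n : ℚ) / 2) ?_
    exact (f.zeroOrd_cuspFunction_inv 1).trans (zeroOrd_inv_one f.meromorphic_infty this)
  | coe x =>
    obtain ⟨z, rfl⟩ := isOpenQuotientMap_cls.surjective x
    refine congrArg (fun n : ℕ ↦ (n : ℚ) / Nat.card (MulAction.stabilizer (Gamma0Star 5) z)) ?_
    exact zeroOrd_inv_one (f.meromorphic z) (h z)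

/-- The order of the stabilizer of the points of an orbit. -/
def stabCard : Quo → ℕ :=
  Quotient.lift (fun z ↦ Nat.card (MulAction.stabilizer (Gamma0Star 5) z)) (by
    rintro _ z ⟨γ, rfl⟩
    exact card_stabilizer_eq_of_cls_eq (cls_smul γ z))

theorem stabCard_cls (z : ℍ) :
    stabCard (cls z) = Nat.card (MulAction.stabilizer (Gamma0Star 5) z) := rfl

theorem orderAt_cls {k : ℤ} (f : ModularFunction 5 k) (z : ℍ) : f.orderAt (cls z) = f.order z :=
  rfl

/-- The zeros of 1/f are the poles of f, and the positive part of an integer minus its negative part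
is the integer. -/
theorem totalOrd_sub_coe (x : Quo) : f.totalOrd 0 x - f.inv.totalOrd 0 x =
    ((f.orderAt x).untop₀ : ℚ) / stabCard x := by
  obtain ⟨z, rfl⟩ := isOpenQuotientMap_cls.surjective x
  rw [totalOrd_coe, totalOrd_coe, weightedOrd_cls, weightedOrd_cls, zeroOrd_zero, zeroOrd_zero,
    ← sub_div, stabCard_cls, orderAt_cls]
  congr 1
  change ((f.order z).untop₀.toNat : ℚ) - ((f.inv.order z).untop₀.toNat : ℚ) = _
  rw [order_inv, WithTop.untop₀_neg]
  exact_mod_cast Int.toNat_sub_toNat_neg _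

theorem totalOrd_sub_infty : f.totalOrd 0 OnePoint.infty - f.inv.totalOrd 0 OnePoint.infty =
    (f.orderInfty.untop₀ : ℚ) / 2 := by
  rw [totalOrd_infty, totalOrd_infty, zeroOrd_zero, zeroOrd_zero, ← sub_div]
  congr 1
  change (f.orderInfty.untop₀.toNat : ℚ) - (f.inv.orderInfty.untop₀.toNat : ℚ) = _
  rw [orderInfty_inv, WithTop.untop₀_neg]
  exact_mod_cast Int.toNat_sub_toNat_neg _

/-- A constant weight `0` modular function has no zeros and no poles. -/
theorem order_eq_zero_of_subConst {c : ℂ} {z : ℍ} (h : ∀ z, f.order z ≠ ⊤)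
    (hc : (f.subConst c).order z = ⊤) : (∀ w, f.order w = 0) ∧ f.orderInfty = 0 := by
  classical
  have hc0 : c ≠ 0 := by
    rintro rfl
    refine h z ?_
    simp only [order_subConst, sub_zero] at hc
    exact hc
  constructor
  · intro w
    have h1 := meromorphicOrderAt_eq_top_iff.mp
      ((f.subConst c).order_eq_top_of_order_eq_top hc w)
    rw [order, meromorphicOrderAt_congr (f₂ := fun _ ↦ c), meromorphicOrderAt_const, if_neg hc0]
    filter_upwards [h1] with y hy
    exact sub_eq_zero.mp hy
  · have h1 := ((f.subConst c).orderInfty_eq_top_iff z).mpr hc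
    rw [orderInfty_subConst, meromorphicOrderAt_eq_top_iff] at h1
    rw [orderInfty, meromorphicOrderAt_congr (f₂ := fun _ ↦ c), meromorphicOrderAt_const,
      if_neg hc0]
    filter_upwards [h1] with y hy
    exact sub_eq_zero.mp hy

theorem order_subConst_inv_ne_top (h' : ∀ c z, (f.subConst c).order z ≠ ⊤) (c : ℂ) (z : ℍ) :
    (f.inv.subConst c).order z ≠ ⊤ := by
  intro h0
  have h1 := meromorphicOrderAt_eq_top_iff.mp h0
  refine h' c⁻¹ z (meromorphicOrderAt_eq_top_iff.mpr ?_)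
  filter_upwards [h1] with w hw
  have : (f.toFun (ofComplex w))⁻¹ = c := sub_eq_zero.mp hw
  change f.toFun (ofComplex w) - c⁻¹ = 0
  rw [← this, inv_inv, sub_self]

/-- The degree of the divisor of a weight `0` modular function is zero. -/
theorem sum_order_eq_zero (h : ∀ z, f.order z ≠ ⊤) :
    (Function.support fun x ↦ ((f.orderAt x).untop₀ : ℚ) / stabCard x).Finite ∧
      (f.orderInfty.untop₀ : ℚ) / 2 + ∑ᶠ x, ((f.orderAt x).untop₀ : ℚ) / stabCard x = 0 := by
  -- If f is a constant c, then f − c has infinite order and the counting argument does not apply;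
  -- all orders of f are then 0.
  by_cases hconst : ∃ c z, (f.subConst c).order z = ⊤
  · obtain ⟨c, z, hc⟩ := hconst
    obtain ⟨h1, h2⟩ := f.order_eq_zero_of_subConst h hc
    have h3 : (fun x ↦ ((f.orderAt x).untop₀ : ℚ) / stabCard x) = 0 := by
      funext x
      obtain ⟨w, rfl⟩ := isOpenQuotientMap_cls.surjective x
      simp [orderAt_cls, h1]
    rw [h3, h2]
    simp [Pi.zero_def]
  push Not at hconst
  have hinv := f.order_subConst_inv_ne_top hconst
  obtain ⟨hfin, hsum⟩ := f.finsum_totalOrd_eq hconst fun c h0 ↦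
    hconst c UpperHalfPlane.I (((f.subConst c).orderInfty_eq_top_iff _).mp h0)
  obtain ⟨hfin', hsum'⟩ := f.inv.finsum_totalOrd_eq hinv fun c h0 ↦
    hinv c UpperHalfPlane.I (((f.inv.subConst c).orderInfty_eq_top_iff _).mp h0)
  -- The chain N_0(f) = N_1(f) = N_1(1/f) = N_0(1/f).
  have heq : ∑ᶠ x, (f.totalOrd 0 x - f.inv.totalOrd 0 x) = 0 := by
    rw [finsum_sub_distrib (hfin 0) (hfin' 0), hsum 0 1, hsum' 0 1,
      finsum_congr (f.totalOrd_inv_one h), sub_self]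
  have hfins : (Function.support fun x ↦ f.totalOrd 0 x - f.inv.totalOrd 0 x).Finite :=
    ((hfin 0).union (hfin' 0)).subset (Function.support_sub _ _)
  have hcomp : (fun x ↦ ((f.orderAt x).untop₀ : ℚ) / stabCard x) =
      (fun x ↦ f.totalOrd 0 x - f.inv.totalOrd 0 x) ∘ ((↑) : Quo → OnePoint Quo) := by
    funext x
    exact (f.totalOrd_sub_coe x).symm
  constructor
  · rw [hcomp, Function.support_comp_eq_preimage]
    exact hfins.preimage OnePoint.coe_injective.injOn
  · rw [← f.totalOrd_sub_infty, ← heq, ← finsum_mem_univ (fun x ↦ f.totalOrd 0 x - _),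
      ← OnePoint.insert_infty_range_coe, finsum_mem_insert' _ OnePoint.infty_notMem_range_coe
        (hfins.subset Set.inter_subset_right), finsum_mem_range OnePoint.coe_injective, hcomp]
    rfl

end ModularFunction

/-! ### The comparison form Δ(z)Δ(5z). -/

theorem coe_smul_mul_denom (g : SL(2, ℝ)) (z : ℍ) :
    ((g • z : ℍ) : ℂ) * (g.1 1 0 * z + g.1 1 1) = g.1 0 0 * z + g.1 0 1 := by
  have hden : ((g.1 1 0 : ℂ) * (z : ℂ) + (g.1 1 1 : ℂ)) ≠ 0 :=
    UpperHalfPlane.denom_ne_zero (g : GL (Fin 2) ℝ) z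
  have hcoe : ((g • z : ℍ) : ℂ) = (g.1 0 0 * z + g.1 0 1) / (g.1 1 0 * z + g.1 1 1) :=
    UpperHalfPlane.coe_specialLinearGroup_apply g z
  rw [hcoe, div_mul_cancel₀ _ hden]

/-- Stated through w(cz + d) = az + b, the modularity of Δ applies equally to pairs such as (5z, w).
-/
theorem discriminant_eq_of_coe_mul_eq {a b c d : ℤ} (h : a * d - b * c = 1) {z w : ℍ}
    (hw : (w : ℂ) * (c * z + d) = a * z + b) :
    ModularForm.discriminant w = (c * z + d) ^ 12 * ModularForm.discriminant z := by
  let A : SL(2, ℤ) := ⟨!![a, b; c, d], by rw [Matrix.det_fin_two_of]; exact h⟩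
  let g : SL(2, ℝ) := Matrix.SpecialLinearGroup.map (Int.castRingHom ℝ) A
  have hg : g.1 = !![(a : ℝ), (b : ℝ); (c : ℝ), (d : ℝ)] := by
    ext i j
    fin_cases i <;> fin_cases j <;> rfl
  have hden : ((g.1 1 0 : ℂ) * (z : ℂ) + (g.1 1 1 : ℂ)) ≠ 0 :=
    UpperHalfPlane.denom_ne_zero (g : GL (Fin 2) ℝ) z
  have hcoe := coe_smul_mul_denom g z
  simp only [hg, Matrix.of_apply, Matrix.cons_val', Matrix.cons_val_zero, Matrix.cons_val_one,
    Matrix.cons_val_fin_one, Complex.ofReal_intCast] at hden hcoe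
  obtain rfl : g • z = w := by
    rw [← UpperHalfPlane.coe_inj]
    exact mul_right_cancel₀ hden (hcoe.trans hw.symm)
  have h1 := SlashInvariantForm.slash_action_eqn' CuspForm.discriminant
    (γ := (g : GL (Fin 2) ℝ)) (MonoidHom.mem_range.mpr ⟨A, rfl⟩) z
  have h10 : ((g : GL (Fin 2) ℝ) 1 0 : ℝ) = c := congrFun (congrFun hg 1) 0
  have h11 : ((g : GL (Fin 2) ℝ) 1 1 : ℝ) = d := congrFun (congrFun hg 1) 1
  rw [CuspForm.coe_discriminant, h10, h11, Complex.ofReal_intCast, Complex.ofReal_intCast] at h1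
  exact h1

/-- Multiplication by `5` on the upper half plane. -/
def fiveMul (z : ℍ) : ℍ := ⟨5 * z, by simpa using z.im_pos⟩

theorem coe_fiveMul (z : ℍ) : (fiveMul z : ℂ) = 5 * z := rfl

/-- The modular form `Δ(z) Δ(5 z)` of weight `24` for `Γ₀*(5)`. -/
def discFive (z : ℍ) : ℂ := ModularForm.discriminant z * ModularForm.discriminant (fiveMul z)

theorem discFive_ne_zero (z : ℍ) : discFive z ≠ 0 :=
  mul_ne_zero (ModularForm.discriminant_ne_zero z) (ModularForm.discriminant_ne_zero _)

/-- On Γ₀(5), 5γz is the image of 5z under (a, 5b; c, d). A Fricke element swaps the factors: γz is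
the image of 5z under (a, b; c, 5d), and 5γz that of z under (5a, b; c, d). The factor 5¹² that
appears is √5²⁴. -/
theorem discFive_smul {γ : SL(2, ℝ)} (hγ : γ ∈ Gamma0Star 5) (z : ℍ) :
    discFive (γ • z) = ((γ.1 1 0 : ℂ) * z + γ.1 1 1) ^ 24 * discFive z := by
  have h := coe_smul_mul_denom γ z
  set w := γ • z
  unfold discFive
  obtain ⟨a, b, c, d, ⟨hdet, hγ⟩ | ⟨hdet, hγ⟩⟩ := mem_Gamma0Star_five.mp hγ
  · simp only [hγ, Matrix.of_apply, Matrix.cons_val', Matrix.cons_val_zero, Matrix.cons_val_one,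
      Matrix.cons_val_fin_one] at h ⊢
    push_cast at h ⊢
    have e1 := discriminant_eq_of_coe_mul_eq (a := a) (b := b) (c := 5 * c) (d := d) (z := z)
      (w := w) (by linear_combination hdet) (by push_cast; exact h)
    have e2 := discriminant_eq_of_coe_mul_eq (a := a) (b := 5 * b) (c := c) (d := d)
      (z := fiveMul z) (w := fiveMul w) (by linear_combination hdet)
      (by rw [coe_fiveMul, coe_fiveMul]; push_cast; linear_combination 5 * h)
    have e3 : (c : ℂ) * fiveMul z + d = 5 * c * z + d := by
      rw [coe_fiveMul]
      ring
    push_cast at e1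
    rw [e1, e2, e3]
    generalize (5 * c * z + d : ℂ) = j
    ring
  · have h5 : ((√5 : ℝ) : ℂ) * ((√5 : ℝ) : ℂ) = 5 := by
      rw [← Complex.ofReal_mul, Real.mul_self_sqrt (by norm_num)]
      norm_num
    have h5' : ((√5 : ℝ) : ℂ) ≠ 0 := by
      intro h0
      simp [h0] at h5
    simp only [hγ, Matrix.of_apply, Matrix.cons_val', Matrix.cons_val_zero, Matrix.cons_val_one,
      Matrix.cons_val_fin_one] at h ⊢
    push_cast at h ⊢
    have h' : (w : ℂ) * (5 * (c * z + d)) = 5 * a * z + b := by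
      have h1 : ((√5 : ℝ) : ℂ) * (b / ((√5 : ℝ) : ℂ)) = b := mul_div_cancel₀ _ h5'
      linear_combination ((√5 : ℝ) : ℂ) * h - (w * (c * z + d) - a * z) * h5 + h1
    have e1 := discriminant_eq_of_coe_mul_eq (a := a) (b := b) (c := c) (d := 5 * d)
      (z := fiveMul z) (w := w) (by linear_combination hdet)
      (by rw [coe_fiveMul]; push_cast; linear_combination h')
    have e2 := discriminant_eq_of_coe_mul_eq (a := 5 * a) (b := b) (c := c) (d := d) (z := z)
      (w := fiveMul w) (by linear_combination hdet)
      (by rw [coe_fiveMul]; push_cast; linear_combination h')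
    have e3 : (c : ℂ) * fiveMul z + (5 * d : ℤ) = 5 * (c * z + d) := by
      rw [coe_fiveMul]
      push_cast
      ring
    have e4 : ((√5 : ℝ) : ℂ) * c * z + ((√5 : ℝ) : ℂ) * d = ((√5 : ℝ) : ℂ) * (c * z + d) := by ring
    rw [e1, e2, e3, e4, ← h5]
    generalize (c * z + d : ℂ) = j
    ring

theorem analyticAt_discFive (z : ℍ) : AnalyticAt ℂ (discFive ∘ ofComplex) z := by
  have hd : DifferentiableOn ℂ (ModularForm.discriminant ∘ ofComplex)
      UpperHalfPlane.upperHalfPlaneSet :=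
    UpperHalfPlane.mdifferentiable_iff.mp CuspForm.discriminant.holo'
  have han (w : ℍ) : AnalyticAt ℂ (ModularForm.discriminant ∘ ofComplex) w :=
    hd.analyticAt (UpperHalfPlane.isOpen_upperHalfPlaneSet.mem_nhds w.im_pos)
  have h5 : AnalyticAt ℂ (fun w : ℂ ↦ (ModularForm.discriminant ∘ ofComplex) (5 * w)) z :=
    AnalyticAt.fun_comp (g := ModularForm.discriminant ∘ ofComplex) (han (fiveMul z)) (by fun_prop)
  refine ((han z).mul h5).congr ?_
  filter_upwards [UpperHalfPlane.isOpen_upperHalfPlaneSet.mem_nhds z.im_pos] with w hw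
  have hw5 : 0 < (5 * w).im := by simpa using hw
  have : ofComplex (5 * w) = fiveMul (ofComplex w) := by
    rw [← UpperHalfPlane.coe_inj, coe_fiveMul, UpperHalfPlane.ofComplex_apply_of_im_pos hw,
      UpperHalfPlane.ofComplex_apply_of_im_pos hw5]
  simp [discFive, this]

theorem meromorphicOrderAt_discFive (z : ℍ) :
    meromorphicOrderAt (discFive ∘ ofComplex) z = 0 := by
  rw [(analyticAt_discFive z).meromorphicOrderAt_eq,
    (analyticAt_discFive z).analyticOrderAt_eq_zero.mpr (by simpa using discFive_ne_zero z)]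
  rfl

theorem discriminant_eq_qParam (z : ℍ) : ModularForm.discriminant z =
    qParam 1 z * ∏' i : ℕ, (1 - qParam 1 z ^ (i + 1)) ^ 24 :=
  ModularForm.discriminant_eq_q_prod z

/-- The modular form `Δ(z) Δ(5 z)` has a zero of order `6` at the cusp. -/
theorem exists_cuspFunction_discFive_eq : ∃ g : ℂ → ℂ, AnalyticAt ℂ g 0 ∧ g 0 ≠ 0 ∧
    ∀ᶠ q in 𝓝[≠] (0 : ℂ), cuspFunction 1 discFive q = (q - 0) ^ (6 : ℤ) • g q := by
  set h : ℂ → ℂ := fun q ↦ ∏' i : ℕ, (1 - q ^ (i + 1)) ^ 24 with hh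
  have han : AnalyticAt ℂ h 0 := (ModularForm.differentiableOn_tprod_one_sub_pow_pow 24).analyticAt
    (Metric.ball_mem_nhds _ one_pos)
  have h0 : h 0 = 1 := by simp [hh]
  have han5 : AnalyticAt ℂ (fun q ↦ h (q ^ 5)) 0 :=
    AnalyticAt.fun_comp (g := h) (by simpa using han) (by fun_prop)
  -- The product formula gives q from Δ(z) and q⁵ from Δ(5z), times units.
  refine ⟨fun q ↦ h q * h (q ^ 5), han.fun_mul han5, by simp [h0], ?_⟩
  filter_upwards [self_mem_nhdsWithin, nhdsWithin_le_nhds (Metric.ball_mem_nhds (0 : ℂ) one_pos)]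
    with q hq hq1
  have him := Function.Periodic.im_invQParam_pos_of_norm_lt_one one_pos
    (by simpa [dist_zero_right] using hq1) hq
  rw [cuspFunction_apply_of_ne_zero _ hq, UpperHalfPlane.ofComplex_apply_of_im_pos him]
  set z : ℍ := ⟨invQParam 1 q, him⟩
  have hz : qParam 1 z = q := qParam_right_inv one_ne_zero hq
  have hz5 : qParam 1 (fiveMul z) = q ^ 5 := by
    rw [← hz, coe_fiveMul, qParam, qParam, ← Complex.exp_nat_mul]
    congr 1
    push_cast
    ring
  rw [discFive, discriminant_eq_qParam, discriminant_eq_qParam, hz, hz5, sub_zero, smul_eq_mul]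
  change q * h q * (q ^ 5 * h (q ^ 5)) = _
  norm_cast
  ring

theorem meromorphicAt_cuspFunction_discFive : MeromorphicAt (cuspFunction 1 discFive) 0 := by
  obtain ⟨g, hg, -, h⟩ := exists_cuspFunction_discFive_eq
  refine MeromorphicAt.congr ?_ (h.mono fun _ h ↦ h.symm)
  fun_prop

theorem meromorphicOrderAt_cuspFunction_discFive :
    meromorphicOrderAt (cuspFunction 1 discFive) 0 = (6 : ℤ) :=
  (meromorphicOrderAt_eq_int_iff meromorphicAt_cuspFunction_discFive).mpr
    exists_cuspFunction_discFive_eq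

/-! ### Normalization to weight 0 and the valence formula. -/

namespace ModularFunction

variable {k : ℤ} (f : ModularFunction 5 k)

theorem eventuallyEq_cuspFunction_mul (m : ℕ) (n : ℤ) :
    (cuspFunction 1 f.toFun ^ m * cuspFunction 1 discFive ^ n) =ᶠ[𝓝[≠] 0]
      cuspFunction 1 (fun z ↦ f.toFun z ^ m * discFive z ^ n) := by
  filter_upwards [self_mem_nhdsWithin] with q hq
  simp only [Pi.mul_apply, Pi.pow_apply, cuspFunction_apply_of_ne_zero _ hq]

/-- The modular function `f ^ 24 / (Δ(z) Δ(5 z)) ^ k` of weight `0`. -/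
def normalize : ModularFunction 5 0 where
  toFun z := f.toFun z ^ 24 * discFive z ^ (-k)
  meromorphic z := ((f.meromorphic z).fun_pow 24).fun_mul
    ((analyticAt_discFive z).meromorphicAt.fun_zpow (-k))
  transform γ hγ := by
    filter_upwards [f.transform γ hγ] with z hz
    have hden : ((γ.1 1 0 : ℂ) * (z : ℂ) + (γ.1 1 1 : ℂ)) ≠ 0 :=
      UpperHalfPlane.denom_ne_zero (γ : GL (Fin 2) ℝ) z
    rw [hz, discFive_smul hγ, mul_pow, mul_zpow, mul_mul_mul_comm, ← zpow_natCast, ← zpow_natCast,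
      ← zpow_mul, ← zpow_natCast, ← zpow_mul, ← zpow_add₀ hden, mul_comm k, ← mul_add, add_neg_cancel,
      mul_zero]
  meromorphic_infty := ((f.meromorphic_infty.pow 24).mul
    (meromorphicAt_cuspFunction_discFive.zpow (-k))).congr (f.eventuallyEq_cuspFunction_mul 24 (-k))

theorem order_normalize (z : ℍ) : f.normalize.order z = 24 * f.order z := by
  change meromorphicOrderAt ((f.toFun ∘ ofComplex) ^ 24 * (discFive ∘ ofComplex) ^ (-k)) (z : ℂ) = _
  rw [meromorphicOrderAt_mul ((f.meromorphic z).pow 24)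
    ((analyticAt_discFive z).meromorphicAt.zpow (-k)), meromorphicOrderAt_pow (f.meromorphic z),
    meromorphicOrderAt_zpow (analyticAt_discFive z).meromorphicAt, meromorphicOrderAt_discFive,
    mul_zero, add_zero]
  rfl

theorem orderInfty_normalize :
    f.normalize.orderInfty = 24 * f.orderInfty + ((-k : ℤ) : WithTop ℤ) * (6 : ℤ) := by
  unfold orderInfty
  rw [normalize, ← meromorphicOrderAt_congr (f.eventuallyEq_cuspFunction_mul 24 (-k)),
    meromorphicOrderAt_mul (f.meromorphic_infty.pow 24)
    (meromorphicAt_cuspFunction_discFive.zpow (-k)), meromorphicOrderAt_pow f.meromorphic_infty,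
    meromorphicOrderAt_zpow meromorphicAt_cuspFunction_discFive,
    meromorphicOrderAt_cuspFunction_discFive]
  rfl

end ModularFunction

/-- The classes of the points of the upper half plane with a nontrivial stabilizer. -/
def ellipticClasses : Finset Quo :=
  open scoped Classical in {cls iDivSqrtFive, cls rho51, cls rho52}

theorem mem_ellipticClasses {x : Quo} :
    x ∈ ellipticClasses ↔ x = cls iDivSqrtFive ∨ x = cls rho51 ∨ x = cls rho52 := by
  simp [ellipticClasses]

theorem sum_ellipticClasses (F : Quo → ℚ) : ∑ x ∈ ellipticClasses, F x =
    F (cls iDivSqrtFive) + F (cls rho51) + F (cls rho52) := by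
  classical
  rw [ellipticClasses, Finset.sum_insert (by
    simp [cls_iDivSqrtFive_ne_rho51, cls_iDivSqrtFive_ne_rho52]), Finset.sum_pair
    cls_rho51_ne_rho52, add_assoc]

theorem stabCard_of_mem_ellipticClasses {x : Quo} (hx : x ∈ ellipticClasses) :
    ModularFunction.stabCard x = 4 := by
  obtain ⟨z, rfl⟩ := isOpenQuotientMap_cls.surjective x
  rw [ModularFunction.stabCard_cls]
  exact card_stabilizer_eq_four_of_cls (mem_ellipticClasses.mp hx)

theorem stabCard_of_notMem_ellipticClasses {x : Quo} (hx : x ∉ ellipticClasses) :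
    ModularFunction.stabCard x = 2 := by
  obtain ⟨z, rfl⟩ := isOpenQuotientMap_cls.surjective x
  rw [ModularFunction.stabCard_cls]
  exact card_stabilizer_eq_two_of_cls fun h ↦ hx (mem_ellipticClasses.mpr h)

theorem finsum_div_stabCard (F : Quo → ℚ) (hF : (Function.support F).Finite) :
    ∑ᶠ x, F x / ModularFunction.stabCard x =
      (F (cls iDivSqrtFive) + F (cls rho51) + F (cls rho52)) / 4 +
        (∑ᶠ x ∈ (ellipticClasses : Set Quo)ᶜ, F x) / 2 := by
  have hF' : (Function.support fun x ↦ F x / ModularFunction.stabCard x).Finite :=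
    hF.subset fun x hx h0 ↦ hx (by simp [h0])
  rw [← finsum_mem_univ, ← Set.union_compl_self (ellipticClasses : Set Quo),
    finsum_mem_union' disjoint_compl_right (hF'.inter_of_right _) (hF'.inter_of_right _),
    finsum_mem_coe_finset, ← sum_ellipticClasses, Finset.sum_div, div_eq_mul_inv (finsum _),
    finsum_mem_mul]
  congr 1
  · refine Finset.sum_congr rfl fun x hx ↦ ?_
    rw [stabCard_of_mem_ellipticClasses hx]
    norm_num
  · refine finsum_mem_congr rfl fun x hx ↦ ?_
    rw [stabCard_of_notMem_ellipticClasses hx, div_eq_mul_inv]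
    norm_num

namespace ModularFunction

variable {k : ℤ} (f : ModularFunction 5 k)

theorem stabCard_ne_zero (x : Quo) : stabCard x ≠ 0 := by
  by_cases hx : x ∈ ellipticClasses
  · simp [stabCard_of_mem_ellipticClasses hx]
  · simp [stabCard_of_notMem_ellipticClasses hx]

theorem untop₀_orderAt_normalize (x : Quo) :
    (f.normalize.orderAt x).untop₀ = 24 * (f.orderAt x).untop₀ := by
  obtain ⟨z, rfl⟩ := isOpenQuotientMap_cls.surjective x
  rw [orderAt_cls, orderAt_cls, order_normalize]
  exact WithTop.untop₀_mul _ _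

theorem order_normalize_ne_top {z : ℍ} (h : f.order z ≠ ⊤) : f.normalize.order z ≠ ⊤ := by
  lift f.order z to ℤ using h with n hn
  rw [order_normalize, ← hn]
  exact WithTop.coe_ne_top (a := 24 * n)

theorem untop₀_orderInfty_normalize (h : f.orderInfty ≠ ⊤) :
    f.normalize.orderInfty.untop₀ = 24 * f.orderInfty.untop₀ - 6 * k := by
  rw [orderInfty_normalize]
  lift f.orderInfty to ℤ using h with n
  have : (24 * (n : WithTop ℤ) + ((-k : ℤ) : WithTop ℤ) * (6 : ℤ)) =
      ((24 * n - 6 * k : ℤ) : WithTop ℤ) := by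
    rw [sub_eq_add_neg, WithTop.coe_add, WithTop.coe_mul, neg_mul_eq_mul_neg, mul_comm 6,
      WithTop.coe_mul]
    rfl
  rw [this, WithTop.untop₀_coe, WithTop.untop₀_coe]

theorem orderInfty_ne_top (h : ∀ z, f.order z ≠ ⊤) : f.orderInfty ≠ ⊤ := fun h0 ↦
  h UpperHalfPlane.I ((f.orderInfty_eq_top_iff _).mp h0)

theorem finite_support_orderAt (h : ∀ z, f.order z ≠ ⊤) :
    (Function.support fun x ↦ ((f.orderAt x).untop₀ : ℚ)).Finite := by
  refine (f.normalize.sum_order_eq_zero fun z ↦ f.order_normalize_ne_top (h z)).1.subset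
    fun x hx ↦ ?_
  simp only [Function.mem_support, untop₀_orderAt_normalize] at hx ⊢
  refine div_ne_zero ?_ (Nat.cast_ne_zero.mpr (stabCard_ne_zero x))
  push_cast
  exact mul_ne_zero (by norm_num) hx

/-- Degree zero for the normalized function reads (24 v_∞ − 6k)/2 + 24 Σ v/|Stab| = 0; divide by 12.
-/
theorem orderInfty_add_finsum (h : ∀ z, f.order z ≠ ⊤) :
    (f.orderInfty.untop₀ : ℚ) + 2 * ∑ᶠ x, ((f.orderAt x).untop₀ : ℚ) / stabCard x =
      (k : ℚ) / 4 := by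
  have h1 := (f.normalize.sum_order_eq_zero fun z ↦ f.order_normalize_ne_top (h z)).2
  have h2 (x : Quo) : ((f.normalize.orderAt x).untop₀ : ℚ) / stabCard x =
      24 * (((f.orderAt x).untop₀ : ℚ) / stabCard x) := by
    rw [untop₀_orderAt_normalize]
    push_cast
    ring
  rw [finsum_congr h2, ← mul_finsum,
    untop₀_orderInfty_normalize _ (f.orderInfty_ne_top h)] at h1
  push_cast at h1
  linarith

end ModularFunction

end Fricke

end

theorem mainTheorem8 (k : ℤ) (f : Fricke.ModularFunction 5 k) (hf : ¬ f.IsZero) :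
    f.orderInfty ≠ ⊤ ∧ (∀ z : ℍ, f.order z ≠ ⊤) ∧
    {x : MulAction.orbitRel.Quotient (Fricke.Gamma0Star 5) ℍ | f.orderAt x ≠ 0}.Finite ∧
    (f.orderInfty.untop₀ : ℚ)
      + 1 / 2 * ((f.order Fricke.iDivSqrtFive).untop₀ : ℚ)
      + 1 / 2 * ((f.order Fricke.rho51).untop₀ : ℚ)
      + 1 / 2 * ((f.order Fricke.rho52).untop₀ : ℚ)
      + ∑ᶠ x ∈ {x : MulAction.orbitRel.Quotient (Fricke.Gamma0Star 5) ℍ |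
          x ≠ Fricke.cls Fricke.iDivSqrtFive ∧ x ≠ Fricke.cls Fricke.rho51 ∧
          x ≠ Fricke.cls Fricke.rho52}, ((f.orderAt x).untop₀ : ℚ)
      = (k : ℚ) / 4 := by
  have h := f.order_ne_top_of_not_isZero hf
  have hfin := f.finite_support_orderAt h
  refine ⟨f.orderInfty_ne_top h, h, hfin.subset fun x hx ↦ ?_, ?_⟩
  · obtain ⟨z, rfl⟩ := Fricke.isOpenQuotientMap_cls.surjective x
    -- Since `untop₀` also sends `⊤` to 0, a nonzero order gives a nonzero integer only once it is
    -- known to be finite.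
    simp only [Function.mem_support, ne_eq, Int.cast_eq_zero, WithTop.untop₀_eq_zero, not_or]
    exact ⟨hx, h z⟩
  · have hsum := f.orderInfty_add_finsum h
    have hset : {x : MulAction.orbitRel.Quotient (Fricke.Gamma0Star 5) ℍ |
        x ≠ Fricke.cls Fricke.iDivSqrtFive ∧ x ≠ Fricke.cls Fricke.rho51 ∧
        x ≠ Fricke.cls Fricke.rho52} = (Fricke.ellipticClasses : Set _)ᶜ := by
      ext x
      simp [Fricke.mem_ellipticClasses]
    rw [Fricke.finsum_div_stabCard _ hfin, Fricke.ModularFunction.orderAt_cls,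
      Fricke.ModularFunction.orderAt_cls, Fricke.ModularFunction.orderAt_cls] at hsum
    rw [hset, ← hsum]
    ring
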